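/- Let $\mathbb K$ be a field and let $G$ be a finite connected undirected multigraph without loops on the vertex set $[n]$, $n\ge 1$, with $u_{ij}=u_{ji}$ edges between $i$ and $j$. Let $\Lambda_G$ be its Laplacian matrix and let $S=\mathbb K[x_1,\dots,x_n]$. The toppling ideal $I_G\subset S$ is generated by all binomials $\mathbf x^{\mathbf a}-\mathbf x^{\mathbf b}$ with $\mathbf a,\mathbf b\in\mathbb N^n$ and $\mathbf a-\mathbf b\in\operatorname{image}_{\mathbb Z}(\Lambda_G)$. For disjoint $I,J\subseteq[n]$ put $\mathbf x^{I\to J}=\prod_{i\in I}x_i^{\sum_{k\in J}u_{ik}}$. A split is an unordered pair $(I,J)$ of disjoint nonempty sets with $I\cup J=[n]$. Let $M_G\subset S$ be the ideal generated by the monomials $\mathbf x^{I\to[n]\setminus I}$, where $I$ runs over the nonempty subsets of $[n-1]$. (The vertex $n$ is a fixed but arbitrary vertex.) A spanning tree order is a (degree) reverse lexicographic term order on $S$ for which there is a spanning tree $T$ of $G$, rooted at $n$, such that $x_i>x_j$ whenever $i$ is a proper descendant of $j$ in $T$. Let $\mathrm{Cyc}_{n,k}$ be the set of cyclically ordered partitions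 $(I_1,\dots,I_k)$ of $[n]$ into $k$ nonempty blocks, written so that $n\in I_k$. Let $\mathcal{CYC}_G$ be the sequence of free modules $0\leftarrow S^{\mathrm{Cyc}_{n,1}}\leftarrow S^{\mathrm{Cyc}_{n,2}}\leftarrow\cdots\leftarrow S^{\mathrm{Cyc}_{n,n}}\leftarrow 0$ with maps $$(I_1,\dots,I_r)\mapsto\sum_{s=1}^{r-1}(-1)^{s-1}\mathbf x^{I_s\to I_{s+1}}(I_1,\dots,I_s\cup I_{s+1},\dots,I_r)\;-\;\mathbf x^{I_r\to I_1}(I_2,\dots,I_{r-1},I_1\cup I_r),$$ and let $\mathcal{CYC}_G'$ be the same sequence with the last term $-\mathbf x^{I_r\to I_1}(I_2,\dots,I_{r-1},I_1\cup I_r)$ dropped. For a simplicial complex with a Laurent monomial attached to each vertex, label each face by the least common multiple of its vertex labels. The cellular complex it supports has the faces as a basis and the simplicial boundary map in which the entry from a face $F$ to a facet $F'$ of $F$ is multiplied by the quotient of the label of $F$ by the label of $F'$. Let $\mathrm{Bary}(G)$ be the complex of nonempty chains of nonempty subsets $I$ of $[n-1]$, with $I$ labeled by $\mathbf x^{I\to[n]\setminus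 I}$. Let $\mathrm{Apt}(G)$ be the complex of finite nonempty subsets of $\mathbb Z^n/\mathbb Z(1,\dots,1)$ whose elements have pairwise distance at most $1$ in the metric $\operatorname{dist}(\mathbf u,\mathbf v)=\max_{i,j}|u_i+v_j-u_j-v_i|$, with $\mathbf v$ labeled by $\mathbf x^{\Lambda_G\mathbf v}$. Let $L_G$ be the $S$-submodule of $\mathbb K[x_1^{\pm1},\dots,x_n^{\pm1}]$ spanned by all $\mathbf x^{\mathbf w}$ with $\mathbf w\in\operatorname{image}_{\mathbb Z}(\Lambda_G)$. **Theorem.** 1. $I_G$ is generated by the binomials $\mathbf x^{I\to J}-\mathbf x^{J\to I}$, where $(I,J)$ runs over the splits of $[n]$ such that the subgraphs of $G$ induced on $I$ and on $J$ are connected. 2. For every spanning tree order, these binomials form a Gröbner basis of $I_G$, and the initial ideal of $I_G$ is $M_G$. 3. $\mathcal{CYC}_G$ is a free resolution of $S/I_G$, and it is cellular: the cellular complex supported on $\mathrm{Apt}(G)$ is a free resolution of $L_G$, and $\mathcal{CYC}_G$ is, up to signs of the basis elements, its quotient by the translation action of $\mathbb Z^n/\mathbb Z(1,\dots,1)\cong\operatorname{image}_{\mathbb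 Z}(\Lambda_G)$. Here the orbit of a face with vertices $\mathbf a_0,\ \mathbf a_0+\mathbf e_{I_1},\ \dots,\ \mathbf a_0+\mathbf e_{I_1\cup\dots\cup I_{k-1}}$ corresponds to $(I_1,\dots,I_k)$, where $\mathbf e_A$ is the indicator vector of $A$. 4. $\mathcal{CYC}_G'$ is a free resolution of $S/M_G$, and it is cellular: the cellular complex supported on $\mathrm{Bary}(G)$ is a free resolution of $M_G$, and $\mathcal{CYC}_G'$ is that complex augmented by $S$ in homological degree $0$ (the empty face). Here $(I_1,\dots,I_k)$ corresponds to the chain $I_1\subset I_1\cup I_2\subset\dots\subset I_1\cup\dots\cup I_{k-1}$. -/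

import Mathlib

open MvPolynomial

universe u v w

noncomputable section

/-- A loopless undirected multigraph on `V`: `mult i j` is the number `u_{ij}` of edges between
`i` and `j`. -/
structure Multigraph (V : Type u) where
  mult : V → V → ℕ
  symm : ∀ i j, mult i j = mult j i
  loopless : ∀ i, mult i i = 0

namespace Multigraph

variable {V : Type u} [Fintype V] [DecidableEq V]

/-- The underlying simple graph. -/
def toSimpleGraph {V : Type u} (G : Multigraph V) : SimpleGraph V where
  Adj i j := G.mult i j ≠ 0
  symm := ⟨fun i j h => by rwa [G.symm j i]⟩
  loopless := ⟨fun i h => h (G.loopless i)⟩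

/-- Connectedness of the multigraph (in particular, it has a vertex). -/
def Connected {V : Type u} (G : Multigraph V) : Prop := G.toSimpleGraph.Connected

/-- The Laplacian matrix: degrees on the diagonal, `-u_{ij}` off the diagonal. -/
def laplacian (G : Multigraph V) : Matrix V V ℤ :=
  Matrix.of fun i j => if i = j then ∑ k, (G.mult i k : ℤ) else -(G.mult i j : ℤ)

/-- The Laplacian lattice, generated by the columns of the Laplacian. -/
def laplacianLattice (G : Multigraph V) : AddSubgroup (V → ℤ) :=
  AddSubgroup.closure (Set.range fun j => fun i => G.laplacian i j)

/-- The toppling ideal `I_G`, generated by the binomials `x^a - x^b` with `a, b ≥ 0` and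
`a - b` in the Laplacian lattice. -/
def topplingIdeal (G : Multigraph V) (K : Type v) [Field K] : Ideal (MvPolynomial V K) :=
  Ideal.span {f | ∃ a b : V →₀ ℕ, (fun i => (a i : ℤ) - (b i : ℤ)) ∈ G.laplacianLattice ∧
    f = monomial a 1 - monomial b 1}

/-- The exponent vector of `x^{I → J} = ∏_{i ∈ I} x_i ^ (∑_{k ∈ J} u_{ik})`. -/
def arrowExp (G : Multigraph V) (I J : Finset V) : V →₀ ℕ :=
  Finsupp.equivFunOnFinite.symm fun i => if i ∈ I then ∑ k ∈ J, G.mult i k else 0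

/-- The monomial `x^{I → J}`. -/
def arrow (G : Multigraph V) (K : Type v) [Field K] (I J : Finset V) : MvPolynomial V K :=
  monomial (G.arrowExp I J) 1

/-- `(I, J)` is a split of the vertex set: two disjoint nonempty parts covering it. -/
def IsSplit (I J : Finset V) : Prop :=
  I.Nonempty ∧ J.Nonempty ∧ Disjoint I J ∧ I ∪ J = Finset.univ

/-- The subgraph of `G` induced on `I` is connected. -/
def InducesConnected {V : Type u} (G : Multigraph V) (I : Finset V) : Prop :=
  (G.toSimpleGraph.induce (I : Set V)).Connected

/-- The binomials `x^{I → J} - x^{J → I}` for the splits `(I, J)` whose two sides induce connected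
subgraphs.  A split is unordered and its binomial is defined up to sign; both signs are listed. -/
def connectedSplitBinomials (G : Multigraph V) (K : Type v) [Field K] :
    Set (MvPolynomial V K) :=
  {f | ∃ I J : Finset V, IsSplit I J ∧ G.InducesConnected I ∧ G.InducesConnected J ∧
    f = G.arrow K I J - G.arrow K J I}

/-- The ideal `M_G` with respect to the sink `q`, generated by the monomials `x^{I → V \ I}` for
the nonempty sets `I` of vertices different from `q`. -/
def parkingIdeal (G : Multigraph V) (K : Type v) [Field K] (q : V) : Ideal (MvPolynomial V K) :=
  Ideal.span {f | ∃ I : Finset V, I.Nonempty ∧ q ∉ I ∧ f = G.arrow K I Iᶜ}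

end Multigraph

/-! ### Term orders and Gröbner bases -/

section Groebner

variable {V : Type u} {K : Type v} [Field K]

/-- The initial ideal of `I`. -/
def initialIdeal (m : MonomialOrder.{u, w} V) (I : Ideal (MvPolynomial V K)) :
    Ideal (MvPolynomial V K) :=
  Ideal.span (m.leadingTerm '' (I : Set (MvPolynomial V K)))

/-- `B` is a Gröbner basis of `I`: it lies in `I` and its leading terms generate the
initial ideal. -/
def IsGroebnerBasis (m : MonomialOrder.{u, w} V) (B : Set (MvPolynomial V K))
    (I : Ideal (MvPolynomial V K)) : Prop :=
  B ⊆ I ∧ Ideal.span (m.leadingTerm '' B) = initialIdeal m I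

/-- `m` is the (degree) reverse lexicographic term order for the variable order `ord`
(`x_i < x_j` iff `i < j`): `x^a < x^b` iff the degree of `x^a` is smaller, or the degrees agree
and the smallest variable at which `a` and `b` differ has the larger exponent in `x^a`. -/
def IsRevLexOrder (m : MonomialOrder.{u, w} V) (ord : LinearOrder V) : Prop :=
  ∀ a b : V →₀ ℕ, m.toSyn a < m.toSyn b ↔
    a.degree < b.degree ∨
      (a.degree = b.degree ∧ ∃ i, b i < a i ∧ ∀ j, ord.lt j i → a j = b j)

/-- In the tree `T` rooted at `q`, the vertex `i` is a proper descendant of `j`: the path in `T`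
from `i` to the root passes through `j ≠ i`. -/
def IsDescendant (T : SimpleGraph V) (q i j : V) : Prop :=
  i ≠ j ∧ ∃ p : T.Walk i q, p.IsPath ∧ j ∈ p.support

/-- A spanning tree order: a reverse lexicographic term order whose variable order is compatible
with some spanning tree `T` of `G` rooted at `q` (descendants are larger). -/
def Multigraph.IsSpanningTreeOrder (G : Multigraph V) (q : V) (m : MonomialOrder.{u, w} V) :
    Prop :=
  ∃ (T : SimpleGraph V) (ord : LinearOrder V), T ≤ G.toSimpleGraph ∧ T.IsTree ∧
    (∀ i j, IsDescendant T q i j → ord.lt j i) ∧ IsRevLexOrder m ord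

end Groebner

/-! ### Free resolutions -/

/-- The sequence `⋯ → S^(B 1) → S^(B 0) → M → 0` of free modules with bases `B k` is exact,
that is, `(S^(B k), d)` is a free resolution of `M` with augmentation `ε`. -/
def IsFreeResolution {S : Type u} [CommRing S] {M : Type v} [AddCommGroup M] [Module S M]
    {B : ℕ → Type w} (d : ∀ k, (B (k + 1) →₀ S) →ₗ[S] (B k →₀ S)) (ε : (B 0 →₀ S) →ₗ[S] M) :
    Prop :=
  Function.Surjective ε ∧ Function.Exact (d 0) ε ∧ ∀ k, Function.Exact (d (k + 1)) (d k)

/-! ### Cyclically ordered partitions and the complexes `CYC` -/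

/-- `Cyc_{V, k+1}`: cyclically ordered partitions `(I_1, …, I_{k+1})` of `V` into `k + 1` blocks,
each represented by its unique rotation with `q` in the last block (see
`existsUnique_rotation`).  The ordered partition is encoded by the surjection sending a vertex to
the (zero-based) index of its block. -/
@[ext]
structure CyclicPartition {V : Type u} (q : V) (k : ℕ) : Type u where
  toFun : V → Fin (k + 1)
  surjective : Function.Surjective toFun
  map_base : toFun q = Fin.last k

/-- Every ordered partition has exactly one rotation with `q` in the last block. -/
theorem existsUnique_rotation {V : Type u} (q : V) {k : ℕ} (p : V → Fin (k + 1))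
    (hp : Function.Surjective p) :
    ∃! c : Fin (k + 1),
      Function.Surjective (fun i => p i + c) ∧ p q + c = Fin.last k := by
  refine ⟨Fin.last k - p q, ⟨?_, by abel⟩, fun c hc => ?_⟩
  · exact (Equiv.addRight (Fin.last k - p q)).surjective.comp hp
  · rw [← hc.2]; abel

namespace CyclicPartition

variable {V : Type u} {q : V}

/-- The block `I_{s+1}`. -/
def block [Fintype V] {k : ℕ} (p : CyclicPartition q k) (s : Fin (k + 1)) : Finset V :=
  Finset.univ.filter fun i => p.1 i = s

/-- The partition with the single block `V`. -/
def whole (q : V) : CyclicPartition q 0 :=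
  ⟨fun _ => 0, fun s => ⟨q, (Fin.fin_one_eq_zero s).symm⟩, rfl⟩

/-- `(I_1, …, I_{s+1} ∪ I_{s+2}, …, I_r)`, merging the blocks with zero-based indices
`s` and `s + 1`. -/
def merge {k : ℕ} (p : CyclicPartition q (k + 1)) (s : Fin (k + 1)) : CyclicPartition q k :=
  ⟨fun i => s.predAbove (p.1 i), (Fin.predAbove_surjective s).comp p.surjective, by
    simp [p.map_base]⟩

/-- `(I_2, …, I_{r-1}, I_1 ∪ I_r)`. -/
def mergeEnds {k : ℕ} (p : CyclicPartition q (k + 1)) : CyclicPartition q k :=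
  ⟨fun i => Fin.cases (motive := fun _ => Fin (k + 1)) (Fin.last k) id (p.1 i), fun j => by
    obtain ⟨i, hi⟩ := p.surjective j.succ
    exact ⟨i, by simp [hi]⟩, by
    rw [p.map_base, ← Fin.succ_last]; rfl⟩

end CyclicPartition

namespace Multigraph

variable {V : Type u} [Fintype V] [DecidableEq V]

/-- The boundary map of the complex for `M_G`:
`(I_1, …, I_r) ↦ ∑_{s=1}^{r-1} (-1)^(s-1) x^{I_s → I_{s+1}} (I_1, …, I_s ∪ I_{s+1}, …, I_r)`. -/
def cycMonomialD (G : Multigraph V) (K : Type v) [Field K] (q : V) (k : ℕ) :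
    (CyclicPartition q (k + 1) →₀ MvPolynomial V K) →ₗ[MvPolynomial V K]
      (CyclicPartition q k →₀ MvPolynomial V K) :=
  Finsupp.linearCombination (MvPolynomial V K) fun p =>
    ∑ s : Fin (k + 1), Finsupp.single (p.merge s)
      ((-1) ^ (s : ℕ) * G.arrow K (p.block s.castSucc) (p.block s.succ))

/-- The boundary map of `CYC_G`: the previous one with the additional term
`- x^{I_r → I_1} (I_2, …, I_{r-1}, I_1 ∪ I_r)`, where `q ∈ I_r`. -/
def cycD (G : Multigraph V) (K : Type v) [Field K] (q : V) (k : ℕ) :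
    (CyclicPartition q (k + 1) →₀ MvPolynomial V K) →ₗ[MvPolynomial V K]
      (CyclicPartition q k →₀ MvPolynomial V K) :=
  Finsupp.linearCombination (MvPolynomial V K) fun p =>
    ∑ s : Fin (k + 1), Finsupp.single (p.merge s)
      ((-1) ^ (s : ℕ) * G.arrow K (p.block s.castSucc) (p.block s.succ))
    - Finsupp.single p.mergeEnds (G.arrow K (p.block (Fin.last (k + 1))) (p.block 0))

/-- The augmentation `K[x]^{Cyc_{V,1}} = K[x] → K[x]/I`. -/
def cycAug {V : Type u} {K : Type v} [Field K] (q : V) (I : Ideal (MvPolynomial V K)) :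
    (CyclicPartition q 0 →₀ MvPolynomial V K) →ₗ[MvPolynomial V K] (MvPolynomial V K ⧸ I) :=
  Finsupp.linearCombination (MvPolynomial V K) fun _ => 1

end Multigraph

/-! ### Laurent polynomials and cellular complexes -/

/-- Laurent polynomials over `K` in the variables `V`. -/
def Laurent (V : Type u) (K : Type v) [Field K] : Type (max u v) := AddMonoidAlgebra K (V → ℤ)

namespace Laurent

variable {V : Type u} {K : Type v} [Field K]

instance : CommRing (Laurent V K) := inferInstanceAs (CommRing (AddMonoidAlgebra K (V → ℤ)))

instance : Algebra K (Laurent V K) := inferInstanceAs (Algebra K (AddMonoidAlgebra K (V → ℤ)))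

/-- The Laurent monomial `x^a`. -/
def mono (K : Type v) [Field K] (a : V → ℤ) : Laurent V K :=
  (AddMonoidAlgebra.single a (1 : K) : AddMonoidAlgebra K (V → ℤ))

/-- `K[x]` acts on Laurent polynomials through the inclusion `x_i ↦ x_i`. -/
instance [DecidableEq V] : Algebra (MvPolynomial V K) (Laurent V K) :=
  (MvPolynomial.aeval (R := K) fun i : V => mono K (Pi.single i 1)).toAlgebra

end Laurent

/-- A simplicial complex on a partially ordered vertex set all of whose faces are chains (so that
every face carries a linear order of its vertices), with a label `a_w ∈ ℤ^V` on each vertex `w`. -/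
structure LabeledComplex (V : Type u) (W : Type v) [PartialOrder W] extends
    AbstractSimplicialComplex W where
  isChain_of_mem : ∀ s ∈ faces, IsChain (· ≤ ·) (s : Set W)
  label : W → V → ℤ

namespace LabeledComplex

variable {V : Type u} {W : Type v} [PartialOrder W]

/-- The `k`-dimensional faces, listed as increasing sequences `w_0 < ⋯ < w_k` of vertices. -/
@[ext]
structure Face (X : LabeledComplex V W) (k : ℕ) : Type v where
  vertices : Fin (k + 1) ↪o W
  mem_faces : Finset.univ.map vertices.toEmbedding ∈ X.faces

namespace Face

variable {X : LabeledComplex V W} {k : ℕ}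

/-- The label of a face: the exponent of the least common multiple of its vertex labels. -/
def label (σ : X.Face k) : V → ℤ :=
  Finset.univ.sup' Finset.univ_nonempty fun t => X.label (σ.1 t)

/-- The facet obtained by deleting the vertex `w_j`. -/
def delete (σ : X.Face (k + 1)) (j : Fin (k + 2)) : X.Face k :=
  ⟨(Fin.succAboveOrderEmb j).trans σ.1, by
    refine (X.isRelLowerSet_faces σ.2).2 ?_ (Finset.univ_nonempty.map)
    intro w hw
    simp only [Finset.mem_map, Finset.mem_univ, true_and] at hw ⊢
    obtain ⟨t, rfl⟩ := hw
    exact ⟨j.succAbove t, rfl⟩⟩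

end Face

variable [Fintype V]

/-- The boundary map of the cellular free complex supported on `X`:
`σ ↦ ∑_j (-1)^j x^{a_σ - a_{σ \ w_j}} (σ \ w_j)`. -/
def cellularD (X : LabeledComplex V W) (K : Type w) [Field K] (k : ℕ) :
    (X.Face (k + 1) →₀ MvPolynomial V K) →ₗ[MvPolynomial V K]
      (X.Face k →₀ MvPolynomial V K) :=
  Finsupp.linearCombination (MvPolynomial V K) fun σ =>
    ∑ j : Fin (k + 2), Finsupp.single (σ.delete j)
      ((-1) ^ (j : ℕ) * monomial
        (Finsupp.equivFunOnFinite.symm fun i => (σ.label i - (σ.delete j).label i).toNat) 1)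

/-- The augmentation sending a vertex `w` to the Laurent monomial `x^{a_w}`. -/
def cellularAug [DecidableEq V] (X : LabeledComplex V W) (K : Type w) [Field K] :
    (X.Face 0 →₀ MvPolynomial V K) →ₗ[MvPolynomial V K] Laurent V K :=
  Finsupp.linearCombination (MvPolynomial V K) fun σ => Laurent.mono K σ.label

/-- The cellular free complex supported on `X` is a free resolution of the module `M` of
Laurent polynomials. -/
def IsCellularResolution [DecidableEq V] (X : LabeledComplex V W) {K : Type w} [Field K]
    (M : Submodule (MvPolynomial V K) (Laurent V K)) : Prop :=
  LinearMap.range (X.cellularAug K) = M ∧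
    IsFreeResolution (X.cellularD K) (X.cellularAug K).rangeRestrict

end LabeledComplex

/-! ### The complexes `Bary(G)` and `Apt(G)` -/

namespace Multigraph

variable {V : Type u} [Fintype V] [DecidableEq V]

/-- `Bary(G)`: the barycentric subdivision of the simplex on `V \ {q}`.  Its vertices are the
nonempty subsets `I` of `V \ {q}`, its faces the nonempty finite chains of such subsets, and `I` is
labeled by `x^{I → V \ I}`. -/
def bary (G : Multigraph V) (q : V) :
    LabeledComplex V {I : Finset V // I.Nonempty ∧ q ∉ I} where
  faces := {s | s.Nonempty ∧ IsChain (· ≤ ·) (s : Set {I : Finset V // I.Nonempty ∧ q ∉ I})}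
  isRelLowerSet_faces := fun _ hs =>
    ⟨hs.1, fun _ hts ht => ⟨ht, hs.2.mono (Finset.coe_subset.2 hts)⟩⟩
  singleton_mem := fun I => ⟨Finset.singleton_nonempty I, by simp⟩
  isChain_of_mem := fun _ hs => hs.2
  label := fun I i => (G.arrowExp I.1 I.1ᶜ i : ℤ)

/-- `ℤ^V / ℤ(1, …, 1)`, each class being represented by its unique element with `q`-coordinate
zero. -/
abbrev NormVec {V : Type u} (q : V) : Type u := {a : V → ℤ // a q = 0}

/-- The tropical metric `max |a_i + b_j - a_j - b_i|`. -/
def tropDist (a b : V → ℤ) : ℕ :=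
  Finset.univ.sup fun ij : V × V => (a ij.1 + b ij.2 - a ij.2 - b ij.1).natAbs

/-- `Apt(G)`: the flag complex on `ℤ^V / ℤ(1, …, 1)` whose faces are the nonempty finite sets of
classes at pairwise tropical distance at most one; `a` is labeled by `x^{Λ_G a}`. -/
def apt (G : Multigraph V) (q : V) : LabeledComplex V (NormVec q) where
  faces := {s | s.Nonempty ∧ ∀ a ∈ s, ∀ b ∈ s, tropDist a.1 b.1 ≤ 1}
  isRelLowerSet_faces := fun _ hs =>
    ⟨hs.1, fun _ hts ht => ⟨ht, fun a ha b hb => hs.2 a (hts ha) b (hts hb)⟩⟩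
  singleton_mem := fun a => ⟨Finset.singleton_nonempty a, by
    intro b hb c hc
    rw [Finset.mem_singleton] at hb hc
    subst hb hc
    refine Finset.sup_le fun ij _ => ?_
    omega⟩
  isChain_of_mem := fun s hs a ha b hb _ => by
    by_contra h
    rw [not_or] at h
    have h1 : ∃ i, b.1 i < a.1 i := by
      by_contra h'
      exact h.1 (fun i => not_lt.1 fun hi => h' ⟨i, hi⟩)
    have h2 : ∃ j, a.1 j < b.1 j := by
      by_contra h'
      exact h.2 (fun i => not_lt.1 fun hi => h' ⟨i, hi⟩)
    obtain ⟨i, hi⟩ := h1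
    obtain ⟨j, hj⟩ := h2
    have hd := (Finset.sup_le_iff.1 (hs.2 a ha b hb)) (i, j) (Finset.mem_univ _)
    simp only at hd
    omega
  label := fun a => G.laplacian.mulVec a.1

/-- The lattice module `L_G`, spanned by the Laurent monomials with exponent in the
Laplacian lattice. -/
def latticeModule (G : Multigraph V) (K : Type v) [Field K] :
    Submodule (MvPolynomial V K) (Laurent V K) :=
  Submodule.span _ {f | ∃ a ∈ G.laplacianLattice, f = Laurent.mono K a}

/-- The complex with differential `cycMonomialD` is the cellular complex of `Bary(G)` (with the
empty face in homological degree `0`, identified with the partition `(V)`): the partition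
`(I_1, …, I_{k+2})` corresponds to the flag `I_1 ⊂ I_1 ∪ I_2 ⊂ ⋯ ⊂ I_1 ∪ ⋯ ∪ I_{k+1}`. -/
def CycSupportedOnBary (G : Multigraph V) (K : Type v) [Field K] (q : V) : Prop :=
  ∃ e : ∀ k, CyclicPartition q (k + 1) ≃ (G.bary q).Face k,
    (∀ k (p : CyclicPartition q (k + 1)) (t : Fin (k + 1)) (i : V),
      i ∈ ((e k p).1 t).1 ↔ p.1 i ≤ t.castSucc) ∧
    (∀ k (f : CyclicPartition q (k + 2) →₀ MvPolynomial V K),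
      Finsupp.mapDomain (e k) (G.cycMonomialD K q (k + 1) f) =
        (G.bary q).cellularD K k (Finsupp.mapDomain (e (k + 1)) f)) ∧
    (∀ f : CyclicPartition q 1 →₀ MvPolynomial V K,
      algebraMap (MvPolynomial V K) (Laurent V K)
          (G.cycMonomialD K q 0 f (CyclicPartition.whole q)) =
        (G.bary q).cellularAug K (Finsupp.mapDomain (e 0) f))

/-- `CYC_G` is the quotient of the cellular complex of `Apt(G)` by the Laplacian lattice, which
acts on `Apt(G)` by translations: the basis elements of `CYC_G` are the orbits of faces, the face
`a_0 < ⋯ < a_k` giving the partition `(I_1, …, I_{k+1})` with `a_t - a_0` the indicator vector of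
`I_1 ∪ ⋯ ∪ I_t`, and the boundary maps correspond up to the global sign `-1`. -/
def CycSupportedOnApt (G : Multigraph V) (K : Type v) [Field K] (q : V) : Prop :=
  ∃ π : ∀ k, (G.apt q).Face k → CyclicPartition q k,
    (∀ k, Function.Surjective (π k)) ∧
    (∀ k (σ τ : (G.apt q).Face k),
      π k σ = π k τ ↔ ∃ c : NormVec q, ∀ t, (τ.1 t).1 = (σ.1 t).1 + c.1) ∧
    (∀ k (σ : (G.apt q).Face k) (t : Fin (k + 1)) (i : V),
      (σ.1 t).1 i - (σ.1 0).1 i = if (π k σ).1 i < t then 1 else 0) ∧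
    (∀ k (f : (G.apt q).Face (k + 1) →₀ MvPolynomial V K),
      Finsupp.mapDomain (π k) ((G.apt q).cellularD K k f) =
        -(G.cycD K q k (Finsupp.mapDomain (π (k + 1)) f)))

end Multigraph

end

/-! Everything rests on chip firing. Firing a vertex set `I` subtracts from an exponent vector the
Laplacian of the indicator of `I`, which is the exponent of `x^{I → Iᶜ}` minus that of `x^{Iᶜ → I}`.
If `a - b = Λc` with `a, b ≥ 0`, the set where `c` is maximal can be fired at `a` without producing
a negative exponent (`arrowExp_argmax_le`), and this lowers the oscillation of `c`. By induction the
binomials of all splits generate `I_G` (`monomial_sub_monomial_mem`). When one side of a split is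
disconnected, both of its monomials factor and its binomial is a combination of binomials of smaller
cuts, so connected splits suffice.

A spanning tree order makes `x^{I → Iᶜ}` the leading monomial whenever `q ∉ I`. In an element of
`I_G` the coefficients in each class modulo the lattice sum to zero, so the leading monomial is not
minimal in its class. Comparing it with the minimal monomial of the class exhibits a firing set
avoiding `q`, hence a generator of `M_G` dividing it (`exists_arrowExp_le`).

In a fixed degree `b`, a cellular complex is the augmented simplicial chain complex of the vertices
with label at most `b`. It is therefore a resolution once each nonempty sublevel complex is
contractible (`IsFlag.isFreeResolution`). The vertices of a sublevel complex are closed under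
coordinatewise maximum for `Apt(G)` and under union for `Bary(G)`. They are finite in number, so
there is a largest one, and the complex contracts onto it. The contractions are sums of prism
operators on chains of lists with repetitions allowed.

The complex for `M_G` is that of `Bary(G)` in other notation. `CYC_G` is the quotient of the complex
of `Apt(G)` by a free lattice action: choosing one degree in each class modulo the lattice lifts
`CYC_G` to a sum of graded strands of the resolution of `L_G`, so exactness descends. In both cases
the face labels are computed through `later`. -/

namespace Multigraph

variable {V : Type u} [Fintype V] [DecidableEq V]

/-! ### The Laplacian and the firing of vertex sets. -/

theorem laplacian_mulVec_apply (G : Multigraph V) (a : V → ℤ) (i : V) :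
    G.laplacian.mulVec a i = ∑ k, (G.mult i k : ℤ) * (a i - a k) := by
  have h : ∀ k, G.laplacian i k * a k =
      (if i = k then (∑ j, (G.mult i j : ℤ)) * a i else 0) - (G.mult i k : ℤ) * a k := by
    intro k
    by_cases hk : i = k
    · subst hk; simp [laplacian, G.loopless]
    · simp [laplacian, hk]
  simp only [Matrix.mulVec, dotProduct, h, Finset.sum_sub_distrib, Finset.sum_ite_eq,
    Finset.mem_univ, if_true, mul_sub, Finset.sum_mul]

theorem mem_laplacianLattice_iff (G : Multigraph V) {a : V → ℤ} :
    a ∈ G.laplacianLattice ↔ ∃ c : V → ℤ, G.laplacian.mulVec c = a := by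
  have hcol : ∀ j, G.laplacian.mulVec (Pi.single j 1) = fun i => G.laplacian i j := by
    intro j; ext i; simp
  constructor
  · intro h
    induction h using AddSubgroup.closure_induction with
    | mem x hx => obtain ⟨j, rfl⟩ := hx; exact ⟨_, hcol j⟩
    | zero => exact ⟨0, Matrix.mulVec_zero _⟩
    | add x y _ _ hx hy =>
      obtain ⟨c, rfl⟩ := hx
      obtain ⟨d, rfl⟩ := hy
      exact ⟨c + d, Matrix.mulVec_add _ _ _⟩
    | neg x _ hx => obtain ⟨c, rfl⟩ := hx; exact ⟨-c, Matrix.mulVec_neg _ _⟩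
  · rintro ⟨c, rfl⟩
    have : G.laplacian.mulVec c = ∑ j, c j • fun i => G.laplacian i j := by
      ext i
      simp [Matrix.mulVec, dotProduct, mul_comm]
    rw [this]
    exact sum_mem fun j _ => zsmul_mem
      (AddSubgroup.subset_closure (Set.mem_range_self j)) _

theorem laplacian_mulVec_add_const (G : Multigraph V) (a : V → ℤ) (c : ℤ) :
    G.laplacian.mulVec (fun i => a i + c) = G.laplacian.mulVec a := by
  ext i; simp [laplacian_mulVec_apply]

theorem mem_laplacianLattice_iff_normVec (G : Multigraph V) (q : V) {a : V → ℤ} :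
    a ∈ G.laplacianLattice ↔ ∃ c : NormVec q, G.laplacian.mulVec c.1 = a := by
  rw [mem_laplacianLattice_iff]
  constructor
  · rintro ⟨c, rfl⟩
    exact ⟨⟨fun i => c i + -c q, by simp⟩, G.laplacian_mulVec_add_const c _⟩
  · rintro ⟨c, rfl⟩
    exact ⟨_, rfl⟩

@[simp]
theorem arrowExp_apply (G : Multigraph V) (I J : Finset V) (i : V) :
    G.arrowExp I J i = if i ∈ I then ∑ k ∈ J, G.mult i k else 0 := rfl

theorem Connected.exists_mult_ne_zero {G : Multigraph V} (hG : G.Connected) {I : Finset V}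
    (hI : I.Nonempty) (hI' : Iᶜ.Nonempty) : ∃ i ∈ I, ∃ j ∈ Iᶜ, G.mult i j ≠ 0 := by
  obtain ⟨x, hx⟩ := hI
  obtain ⟨y, hy⟩ := hI'
  obtain ⟨p⟩ := hG.preconnected x y
  obtain ⟨d, -, h1, h2⟩ := p.exists_boundary_dart (I : Set V) hx (by simpa using hy)
  exact ⟨d.fst, h1, d.snd, by simpa using h2, d.adj⟩

/-- The set of vertices at which `a` is maximal. -/
def argmax {V : Type u} [Fintype V] (a : V → ℤ) : Finset V := Finset.univ.filter fun i => ∀ k, a k ≤ a i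

theorem mem_argmax {V : Type u} [Fintype V] {a : V → ℤ} {i : V} : i ∈ argmax a ↔ ∀ k, a k ≤ a i := by simp [argmax]

theorem argmax_nonempty {V : Type u} [Fintype V] [Nonempty V] (a : V → ℤ) : (argmax a).Nonempty := by
  obtain ⟨i, hi⟩ := Finite.exists_max a
  exact ⟨i, mem_argmax.2 hi⟩

/-- An edge leaving the set of maxima drops by at least one, the values being integers, and no edge
at a maximum rises. Hence firing this set once costs a vertex in it no more than the whole script
`a` does. -/
theorem arrowExp_argmax_le (G : Multigraph V) (a : V → ℤ) {i : V} (hi : i ∈ argmax a) :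
    (G.arrowExp (argmax a) (argmax a)ᶜ i : ℤ) ≤ G.laplacian.mulVec a i := by
  have hi' := mem_argmax.1 hi
  rw [arrowExp_apply, if_pos hi, laplacian_mulVec_apply, Nat.cast_sum]
  calc ∑ k ∈ (argmax a)ᶜ, (G.mult i k : ℤ)
      ≤ ∑ k ∈ (argmax a)ᶜ, (G.mult i k : ℤ) * (a i - a k) := by
        refine Finset.sum_le_sum fun k hk => ?_
        rw [Finset.mem_compl, mem_argmax, not_forall] at hk
        obtain ⟨l, hl⟩ := hk
        have := hi' l
        exact le_mul_of_one_le_right (by positivity) (by omega)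
    _ ≤ _ := Finset.sum_le_sum_of_subset_of_nonneg (Finset.subset_univ _) fun k _ _ =>
        mul_nonneg (by positivity) (by have := hi' k; omega)

/-- Maximum principle: if the set of maxima were proper, an edge leaving it would make the Laplacian
positive at its inner end. -/
theorem Connected.eq_of_laplacian_mulVec_eq_zero {G : Multigraph V} (hG : G.Connected)
    {a : V → ℤ} (ha : G.laplacian.mulVec a = 0) (i j : V) : a i = a j := by
  have := hG.nonempty
  rcases (argmax a)ᶜ.eq_empty_or_nonempty with h | h
  · rw [Finset.compl_eq_empty_iff] at h
    exact le_antisymm (mem_argmax.1 (h ▸ Finset.mem_univ j) i)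
      (mem_argmax.1 (h ▸ Finset.mem_univ i) j)
  · obtain ⟨x, hx, y, hy, hxy⟩ := hG.exists_mult_ne_zero (argmax_nonempty a) h
    have h1 := G.arrowExp_argmax_le a hx
    rw [ha, arrowExp_apply, if_pos hx] at h1
    have h2 := Finset.single_le_sum (f := fun k => G.mult x k) (fun _ _ => Nat.zero_le _) hy
    simp only [Pi.zero_apply] at h1 h2
    omega

theorem Connected.laplacian_mulVec_injective {G : Multigraph V} (hG : G.Connected) (q : V) :
    Function.Injective fun a : NormVec q => G.laplacian.mulVec a.1 := by
  intro a b hab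
  have h : G.laplacian.mulVec (a.1 - b.1) = 0 := by
    rw [Matrix.mulVec_sub, sub_eq_zero]; exact hab
  ext i
  have := hG.eq_of_laplacian_mulVec_eq_zero h i q
  simp only [Pi.sub_apply, a.2, b.2, sub_self] at this
  omega

/-- The indicator vector of a finite set. -/
def ind (I : Finset V) : V → ℤ := fun i => if i ∈ I then 1 else 0

theorem laplacian_mulVec_ind (G : Multigraph V) (I : Finset V) (i : V) :
    G.laplacian.mulVec (ind I) i = (G.arrowExp I Iᶜ i : ℤ) - G.arrowExp Iᶜ I i := by
  have h : ∀ f : V → ℤ, ∑ k, f k = ∑ k ∈ I, f k + ∑ k ∈ Iᶜ, f k := fun f =>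
    (Finset.sum_add_sum_compl I f).symm
  rw [laplacian_mulVec_apply, h]
  by_cases hi : i ∈ I
  · rw [Finset.sum_eq_zero, zero_add]
    · simp only [arrowExp_apply, hi, Finset.mem_compl, not_true, if_true, if_false, Nat.cast_zero,
        sub_zero, Nat.cast_sum]
      refine Finset.sum_congr rfl fun k hk => ?_
      simp [ind, hi, Finset.mem_compl.1 hk]
    · intro k hk; simp [ind, hi, hk]
  · rw [add_comm, Finset.sum_eq_zero, zero_add]
    · simp only [arrowExp_apply, hi, Finset.mem_compl, not_false_iff, if_true, if_false,
        Nat.cast_zero, zero_sub, Nat.cast_sum, ← Finset.sum_neg_distrib]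
      refine Finset.sum_congr rfl fun k hk => ?_
      simp [ind, hi, hk]
    · intro k hk; simp [ind, hi, Finset.mem_compl.1 hk]

theorem isSplit_compl {I : Finset V} (hI : I.Nonempty) (hI' : Iᶜ.Nonempty) : IsSplit I Iᶜ :=
  ⟨hI, hI', disjoint_compl_right, Finset.union_compl I⟩

theorem IsSplit.eq_compl {I J : Finset V} (h : IsSplit I J) : J = Iᶜ :=
  (IsCompl.of_eq (Finset.disjoint_iff_inter_eq_empty.1 h.2.2.1) h.2.2.2).compl_eq.symm

/-! ### Binomial generators of the toppling ideal. -/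

section Generators

variable {K : Type v} [Field K]

theorem arrow_sub_arrow_mem_topplingIdeal (G : Multigraph V) (I : Finset V) :
    G.arrow K I Iᶜ - G.arrow K Iᶜ I ∈ G.topplingIdeal K := by
  refine Ideal.subset_span ⟨_, _, G.mem_laplacianLattice_iff.2 ⟨ind I, ?_⟩, rfl⟩
  ext i
  exact G.laplacian_mulVec_ind I i

/-- Firing the set of maxima of the script `c` is legal at `a` if the script `c` leads from `a` to
an effective divisor. -/
theorem arrowExp_le_of_sub_eq (G : Multigraph V) {a b : V →₀ ℕ} {c : V → ℤ}
    (h : ∀ i, G.laplacian.mulVec c i = (a i : ℤ) - b i) :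
    G.arrowExp (argmax c) (argmax c)ᶜ ≤ a := by
  intro i
  by_cases hi : i ∈ argmax c
  · have := G.arrowExp_argmax_le c hi
    have := h i
    omega
  · simp [hi]

/-- Induction on a bound for the oscillation of the script `c` from `a` to `b`: firing the maxima of
`c` is legal and leaves a script of smaller oscillation. -/
theorem monomial_sub_monomial_mem (G : Multigraph V) {J : Ideal (MvPolynomial V K)}
    (hJ : ∀ I : Finset V, I.Nonempty → Iᶜ.Nonempty → G.arrow K I Iᶜ - G.arrow K Iᶜ I ∈ J)
    (n : ℕ) : ∀ (a b : V →₀ ℕ) (c : V → ℤ), (∀ i j, c i - c j ≤ n) →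
      (∀ i, G.laplacian.mulVec c i = (a i : ℤ) - b i) →
      (monomial a 1 - monomial b 1 : MvPolynomial V K) ∈ J := by
  induction n with
  | zero =>
    intro a b c hc h
    have hab : a = b := by
      ext i
      have h1 : G.laplacian.mulVec c i = 0 := by
        rw [laplacian_mulVec_apply]
        refine Finset.sum_eq_zero fun k _ => ?_
        have h2 := hc i k
        have h3 := hc k i
        have : c i - c k = 0 := by push_cast at h2 h3; omega
        simp [this]
      have := h i
      omega
    simp [hab]
  | succ n ih =>
    intro a b c hc h
    rcases isEmpty_or_nonempty V with hV | hV
    · simp [Subsingleton.elim a b]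
    rcases (argmax c)ᶜ.eq_empty_or_nonempty with hI | hI
    · rw [Finset.compl_eq_empty_iff] at hI
      refine ih a b c (fun i j => ?_) h
      have := mem_argmax.1 (hI ▸ Finset.mem_univ j) i
      omega
    · set I := argmax c with hIdef
      have hle : G.arrowExp I Iᶜ ≤ a := G.arrowExp_le_of_sub_eq h
      set a' := a - G.arrowExp I Iᶜ with ha'
      have haa' : a = a' + G.arrowExp I Iᶜ := (tsub_add_cancel_of_le hle).symm
      -- The first move of the telescoping sum from `a` to `b` is a monomial multiple of a split
      -- binomial; the rest is left to the induction.
      have h1 : (monomial a 1 - monomial (a' + G.arrowExp Iᶜ I) 1 : MvPolynomial V K) =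
          monomial a' 1 * (G.arrow K I Iᶜ - G.arrow K Iᶜ I) := by
        rw [haa', mul_sub, arrow, arrow, monomial_mul, monomial_mul, one_mul]
      have h2 : (monomial (a' + G.arrowExp Iᶜ I) 1 - monomial b 1 : MvPolynomial V K) ∈ J := by
        refine ih _ _ (c - ind I) (fun i j => ?_) (fun i => ?_)
        · obtain ⟨x, hx⟩ := argmax_nonempty c
          have e1 := mem_argmax.1 hx i
          have e2 := hc x j
          push_cast at e2
          -- With `x` a maximum of `c`, every new value is at most `c x - 1`, while by `e4` none
          -- lies below `c x - 1 - n`.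
          have e3 : c i - ind I i ≤ c x - 1 := by
            by_cases hi : i ∈ I
            · simp only [ind, hi, if_true]; omega
            · simp only [ind, hi, if_false]
              have : ¬ (∀ k, c k ≤ c i) := fun h' => hi (mem_argmax.2 h')
              rw [not_forall] at this
              obtain ⟨k, hk⟩ := this
              have := mem_argmax.1 hx k
              omega
          have e4 : c x - 1 - n ≤ c j - ind I j := by
            by_cases hj : j ∈ I
            · have := mem_argmax.1 hj x
              simp only [ind, hj, if_true]; omega
            · simp only [ind, hj, if_false]; omega
          simp only [Pi.sub_apply]
          omega
        · rw [Matrix.mulVec_sub, Pi.sub_apply, laplacian_mulVec_ind, h i]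
          have := DFunLike.congr_fun haa' i
          rw [Finsupp.add_apply] at this
          rw [Finsupp.add_apply]
          push_cast
          omega
      have := J.add_mem (J.mul_mem_left (monomial a' 1) (hJ I (argmax_nonempty c) hI)) h2
      rw [← h1] at this
      simpa using this

theorem topplingIdeal_le (G : Multigraph V) {J : Ideal (MvPolynomial V K)}
    (hJ : ∀ I : Finset V, I.Nonempty → Iᶜ.Nonempty → G.arrow K I Iᶜ - G.arrow K Iᶜ I ∈ J) :
    G.topplingIdeal K ≤ J := by
  refine Ideal.span_le.2 ?_
  rintro f ⟨a, b, hab, rfl⟩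
  obtain ⟨c, hc⟩ := G.mem_laplacianLattice_iff.1 hab
  -- Any bound for the oscillation will do; the sum of all differences is one.
  refine G.monomial_sub_monomial_mem hJ (∑ i, ∑ j, (c i - c j).natAbs) a b c (fun i j => ?_)
    (fun i => congrFun hc i)
  have h1 := Finset.single_le_sum (f := fun j => (c i - c j).natAbs)
    (fun _ _ => Nat.zero_le _) (Finset.mem_univ j)
  have h2 := Finset.single_le_sum (f := fun i => ∑ j, (c i - c j).natAbs)
    (fun _ _ => Nat.zero_le _) (Finset.mem_univ i)
  have h3 : (c i - c j).natAbs ≤ ∑ i, ∑ j, (c i - c j).natAbs := h1.trans h2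
  omega

/-- A set of vertices that does not induce a connected subgraph is a union of two parts without
edges between them. -/
theorem exists_separation {V : Type u} [DecidableEq V] (G : Multigraph V) {I : Finset V} (hI : I.Nonempty)
    (h : ¬ G.InducesConnected I) : ∃ A B : Finset V, A.Nonempty ∧ B.Nonempty ∧ Disjoint A B ∧
      A ∪ B = I ∧ ∀ a ∈ A, ∀ b ∈ B, G.mult a b = 0 := by
  classical
  set H := G.toSimpleGraph.induce (I : Set V) with hH
  have hne : Nonempty (I : Set V) := ⟨⟨hI.choose, hI.choose_spec⟩⟩
  have : ∃ x y, ¬ H.Reachable x y := by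
    by_contra hc
    push Not at hc
    exact h ⟨hc⟩
  obtain ⟨x, y, hxy⟩ := this
  refine ⟨I.filter fun z => ∃ hz : z ∈ I, H.Reachable x ⟨z, hz⟩,
    I.filter fun z => ¬ ∃ hz : z ∈ I, H.Reachable x ⟨z, hz⟩, ⟨x, ?_⟩, ⟨y, ?_⟩,
    Finset.disjoint_filter_filter_not _ _ _, Finset.filter_union_filter_not_eq _ _, ?_⟩
  · exact Finset.mem_filter.2 ⟨x.2, x.2, SimpleGraph.Reachable.refl x⟩
  · exact Finset.mem_filter.2 ⟨y.2, fun ⟨_, h⟩ => hxy h⟩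
  · intro a ha b hb
    obtain ⟨ha, _, har⟩ := Finset.mem_filter.1 ha
    obtain ⟨hb, hbr⟩ := Finset.mem_filter.1 hb
    by_contra hab
    refine hbr ⟨hb, har.trans (SimpleGraph.Adj.reachable ?_)⟩
    exact hab

theorem arrowExp_union (G : Multigraph V) {A B : Finset V} (hd : Disjoint A B)
    (h : ∀ a ∈ A, ∀ b ∈ B, G.mult a b = 0) :
    G.arrowExp (A ∪ B) (A ∪ B)ᶜ = G.arrowExp A Aᶜ + G.arrowExp B Bᶜ := by
  have key : ∀ (A B : Finset V), Disjoint A B → (∀ a ∈ A, ∀ b ∈ B, G.mult a b = 0) →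
      ∀ i ∈ A, ∑ k ∈ (A ∪ B)ᶜ, G.mult i k = ∑ k ∈ Aᶜ, G.mult i k := by
    intro A B hd h i hi
    refine Finset.sum_subset (by simp) fun k hk hk' => h i hi k ?_
    simp only [Finset.mem_compl, Finset.mem_union] at hk hk'
    tauto
  ext i
  rw [Finsupp.add_apply, arrowExp_apply, arrowExp_apply, arrowExp_apply]
  by_cases hA : i ∈ A
  · have hB : i ∉ B := Finset.disjoint_left.1 hd hA
    rw [if_pos (Finset.mem_union_left _ hA), key A B hd h i hA, if_pos hA, if_neg hB, add_zero]
  · by_cases hB : i ∈ B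
    · rw [Finset.union_comm A B, if_pos (Finset.mem_union_left _ hB), key B A hd.symm
        (fun b hb a ha => by rw [G.symm]; exact h a ha b hb) i hB, if_pos hB, if_neg hA, zero_add]
    · simp [hA, hB]

theorem arrowExp_compl_union (G : Multigraph V) {A B : Finset V} (hd : Disjoint A B)
    (h : ∀ a ∈ A, ∀ b ∈ B, G.mult a b = 0) :
    G.arrowExp (A ∪ B)ᶜ (A ∪ B) = G.arrowExp Aᶜ A + G.arrowExp Bᶜ B := by
  ext i
  rw [Finsupp.add_apply, arrowExp_apply, arrowExp_apply, arrowExp_apply]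
  by_cases hA : i ∈ A
  · have hB : i ∉ B := Finset.disjoint_left.1 hd hA
    have : ∑ k ∈ B, G.mult i k = 0 := Finset.sum_eq_zero fun k hk => h i hA k hk
    simp [hA, hB, this]
  · by_cases hB : i ∈ B
    · have : ∑ k ∈ A, G.mult i k = 0 :=
        Finset.sum_eq_zero fun k hk => by rw [G.symm]; exact h k hk i hB
      simp [hA, hB, this]
    · simp [hA, hB, Finset.sum_union hd]

/-- Twice the number of edges in the cut `(I, Iᶜ)`. -/
noncomputable def cutSize (G : Multigraph V) (I : Finset V) : ℕ :=
  (G.arrowExp I Iᶜ).degree + (G.arrowExp Iᶜ I).degree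

theorem cutSize_compl (G : Multigraph V) (I : Finset V) : G.cutSize Iᶜ = G.cutSize I := by
  rw [cutSize, cutSize, compl_compl, add_comm]

/-- The cut of `A ∪ B` consists of the cuts of `A` and of `B`, and connectedness gives `B` at least
one boundary edge. -/
theorem Connected.cutSize_lt {G : Multigraph V} (hG : G.Connected) {A B : Finset V}
    (hA : A.Nonempty) (hB : B.Nonempty) (hd : Disjoint A B)
    (h : ∀ a ∈ A, ∀ b ∈ B, G.mult a b = 0) : G.cutSize A < G.cutSize (A ∪ B) := by
  rw [cutSize, cutSize, arrowExp_union G hd h, arrowExp_compl_union G hd h, map_add, map_add]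
  have : (G.arrowExp B Bᶜ).degree ≠ 0 := by
    rw [Ne, Finsupp.degree_eq_zero_iff]
    intro h0
    obtain ⟨x, hx⟩ := hA
    obtain ⟨i, hi, j, hj, hij⟩ := hG.exists_mult_ne_zero hB
      ⟨x, Finset.mem_compl.2 (Finset.disjoint_left.1 hd hx)⟩
    have h1 := DFunLike.congr_fun h0 i
    rw [arrowExp_apply, if_pos hi] at h1
    exact hij (Finset.sum_eq_zero_iff.1 h1 j hj)
  omega

/-- Strong induction on the size of the cut. If `I` falls into `A` and `B` without edges between
them, both monomials of the split factor, and `ab - a'b' = b(a - a') + a'(b - b')` reduces to the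
smaller cuts of `A` and `B`. -/
theorem Connected.arrow_sub_arrow_mem_span {G : Multigraph V} (hG : G.Connected) (n : ℕ) :
    ∀ I : Finset V, G.cutSize I = n → I.Nonempty → Iᶜ.Nonempty →
      G.arrow K I Iᶜ - G.arrow K Iᶜ I ∈ Ideal.span (G.connectedSplitBinomials K) := by
  induction n using Nat.strong_induction_on with
  | _ n ih =>
    have key : ∀ I : Finset V, G.cutSize I = n → I.Nonempty → Iᶜ.Nonempty →
        ¬ G.InducesConnected I →
        G.arrow K I Iᶜ - G.arrow K Iᶜ I ∈ Ideal.span (G.connectedSplitBinomials K) := by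
      intro I hn hI hI' hc
      obtain ⟨A, B, hA, hB, hd, rfl, h⟩ := G.exists_separation hI hc
      have hA' : Aᶜ.Nonempty := hI'.mono (by simp)
      have hB' : Bᶜ.Nonempty := hI'.mono (by simp)
      have h1 := ih _ (hn ▸ hG.cutSize_lt hA hB hd h) A rfl hA hA'
      have h' : ∀ b ∈ B, ∀ a ∈ A, G.mult b a = 0 := fun b hb a ha => by
        rw [G.symm]; exact h a ha b hb
      have h2 := ih _ (hn ▸ (Finset.union_comm A B ▸ hG.cutSize_lt hB hA hd.symm h')) B rfl hB hB'
      have e : ∀ a b : V →₀ ℕ, (monomial (a + b) 1 : MvPolynomial V K) =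
          monomial a 1 * monomial b 1 := fun a b => by rw [monomial_mul, one_mul]
      have : G.arrow K (A ∪ B) (A ∪ B)ᶜ - G.arrow K (A ∪ B)ᶜ (A ∪ B) =
          G.arrow K B Bᶜ * (G.arrow K A Aᶜ - G.arrow K Aᶜ A) +
          G.arrow K Aᶜ A * (G.arrow K B Bᶜ - G.arrow K Bᶜ B) := by
        simp only [arrow]
        rw [arrowExp_union G hd h, arrowExp_compl_union G hd h, e, e]
        ring
      rw [this]
      exact Ideal.add_mem _ (Ideal.mul_mem_left _ _ h1) (Ideal.mul_mem_left _ _ h2)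
    intro I hn hI hI'
    by_cases h1 : G.InducesConnected I
    · by_cases h2 : G.InducesConnected Iᶜ
      · exact Ideal.subset_span ⟨I, Iᶜ, isSplit_compl hI hI', h1, h2, rfl⟩
      -- Exchanging the two sides only changes the sign of the binomial.
      · have := key Iᶜ (by rw [cutSize_compl, hn]) hI' (by rwa [compl_compl]) h2
        rw [compl_compl] at this
        simpa using neg_mem this
    · exact key I hn hI hI' h1

theorem Connected.topplingIdeal_eq_span {G : Multigraph V} (hG : G.Connected) :
    G.topplingIdeal K = Ideal.span (G.connectedSplitBinomials K) := by
  refine le_antisymm (G.topplingIdeal_le fun I => hG.arrow_sub_arrow_mem_span _ I rfl)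
    (Ideal.span_le.2 ?_)
  rintro f ⟨I, J, hIJ, -, -, rfl⟩
  rw [hIJ.eq_compl]
  exact G.arrow_sub_arrow_mem_topplingIdeal I

/-- The generators of `M_G` are multiples of the ones for connected splits. -/
theorem Connected.exists_connected_arrowExp_le {G : Multigraph V} (hG : G.Connected) (q : V)
    (n : ℕ) : ∀ I : Finset V, G.cutSize I = n → I.Nonempty → q ∉ I →
      ∃ D : Finset V, D.Nonempty ∧ q ∉ D ∧ G.InducesConnected D ∧ G.InducesConnected Dᶜ ∧
        G.arrowExp D Dᶜ ≤ G.arrowExp I Iᶜ := by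
  induction n using Nat.strong_induction_on with
  | _ n ih =>
    intro I hn hI hq
    by_cases h1 : G.InducesConnected I
    · by_cases h2 : G.InducesConnected Iᶜ
      · exact ⟨I, hI, hq, h1, h2, le_rfl⟩
      -- Here `A` is the part of `Iᶜ` containing `q`. Enlarging `I` to `Aᶜ = I ∪ B` keeps `q`
      -- outside and removes the edges to `B`, so the new monomial divides the old one.
      · have key : ∀ A B : Finset V, A.Nonempty → B.Nonempty → Disjoint A B → A ∪ B = Iᶜ →
            (∀ a ∈ A, ∀ b ∈ B, G.mult a b = 0) → q ∈ A →
            ∃ D : Finset V, D.Nonempty ∧ q ∉ D ∧ G.InducesConnected D ∧ G.InducesConnected Dᶜ ∧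
              G.arrowExp D Dᶜ ≤ G.arrowExp I Iᶜ := by
          intro A B hA hB hd hAB h hqA
          have hIA : I ⊆ Aᶜ := by
            rw [Finset.subset_compl_comm, ← hAB]; exact Finset.subset_union_left
          obtain ⟨D, hD, hqD, hD1, hD2, hle⟩ := ih (G.cutSize Aᶜ) (by
            rw [← hn, cutSize_compl, ← G.cutSize_compl I, ← hAB]
            exact hG.cutSize_lt hA hB hd h) Aᶜ rfl (hI.mono hIA) (by simpa using hqA)
          refine ⟨D, hD, hqD, hD1, hD2, hle.trans ?_⟩
          have := G.arrowExp_compl_union hd h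
          rw [hAB, compl_compl] at this
          rw [this, compl_compl]
          exact le_self_add
        obtain ⟨A, B, hA, hB, hd, hAB, h⟩ := G.exists_separation ⟨q, Finset.mem_compl.2 hq⟩ h2
        have hqAB : q ∈ A ∪ B := hAB ▸ Finset.mem_compl.2 hq
        rcases Finset.mem_union.1 hqAB with hqA | hqB
        · exact key A B hA hB hd hAB h hqA
        · exact key B A hB hA hd.symm (by rw [Finset.union_comm, hAB])
            (fun b hb a ha => by rw [G.symm]; exact h a ha b hb) hqB
    · obtain ⟨A, B, hA, hB, hd, rfl, h⟩ := G.exists_separation hI h1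
      obtain ⟨D, hD, hqD, hD1, hD2, hle⟩ := ih _ (hn ▸ hG.cutSize_lt hA hB hd h) A rfl hA
        (fun hqA => hq (Finset.mem_union_left _ hqA))
      refine ⟨D, hD, hqD, hD1, hD2, hle.trans ?_⟩
      rw [G.arrowExp_union hd h]
      exact le_self_add

end Generators

end Multigraph

/-! ### Spanning tree orders and the initial ideal. -/

namespace Multigraph

variable {V : Type u} [Fintype V] [DecidableEq V] {K : Type v} [Field K]

theorem degree_arrowExp (G : Multigraph V) (I J : Finset V) :
    (G.arrowExp I J).degree = ∑ i ∈ I, ∑ k ∈ J, G.mult i k := by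
  rw [Finsupp.degree_eq_sum]
  simp [Finset.sum_ite_mem]

theorem degree_arrowExp_comm (G : Multigraph V) (I J : Finset V) :
    (G.arrowExp I J).degree = (G.arrowExp J I).degree := by
  rw [degree_arrowExp, degree_arrowExp, Finset.sum_comm]
  exact Finset.sum_congr rfl fun i _ => Finset.sum_congr rfl fun k _ => G.symm k i

/-- The degrees agree, so the smallest variable with different exponents decides. From any vertex of
`I` the tree path to `q` leaves `I` at a smaller vertex whose exponents differ, so the deciding
variable lies outside `I`, where only `x^{Iᶜ → I}` can have a positive exponent. -/
theorem IsSpanningTreeOrder.arrowExp_lt {G : Multigraph V} {q : V} {m : MonomialOrder.{u, w} V}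
    (hm : G.IsSpanningTreeOrder q m) {I : Finset V} (hI : I.Nonempty) (hq : q ∉ I) :
    m.toSyn (G.arrowExp Iᶜ I) < m.toSyn (G.arrowExp I Iᶜ) := by
  obtain ⟨T, ord, hTG, hT, hdesc, hlex⟩ := hm
  refine (hlex _ _).2 (Or.inr ⟨G.degree_arrowExp_comm _ _, ?_⟩)
  set S : Set V := {i | G.arrowExp Iᶜ I i ≠ G.arrowExp I Iᶜ i} with hS
  have hmemS : ∀ i ∈ I, ∀ j ∈ Iᶜ, G.mult i j ≠ 0 → j ∈ S := by
    intro i hi j hj hij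
    have hj' : j ∉ I := Finset.mem_compl.1 hj
    simp only [hS, Set.mem_ofPred_eq, arrowExp_apply, hj, hj', if_true, if_false]
    intro h0
    exact hij (G.symm j i ▸ Finset.sum_eq_zero_iff.1 h0 i hi)
  have hcross : ∀ i ∈ I, ∃ j ∈ S, ord.lt j i := by
    intro i hi
    obtain ⟨p, hp⟩ := hT.connected.preconnected.exists_isPath i q
    obtain ⟨d, hd, h1, h2⟩ := p.exists_boundary_dart (I : Set V) hi hq
    have hjI : d.snd ∉ I := h2
    refine ⟨d.snd, hmemS _ h1 _ (Finset.mem_compl.2 hjI) (hTG d.adj), hdesc i d.snd ⟨?_, p, hp, ?_⟩⟩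
    · rintro h; exact hjI (h ▸ hi)
    · exact p.dart_snd_mem_support_of_mem_darts hd
  obtain ⟨x, hx⟩ := hI
  obtain ⟨j, hj, -⟩ := hcross x hx
  have hwf : WellFounded ord.lt :=
    @Finite.wellFounded_of_trans_of_irrefl V _ ord.lt ⟨fun _ _ _ => @lt_trans V ord.toPreorder _ _ _⟩
      ⟨fun a => @lt_irrefl V ord.toPreorder a⟩
  obtain ⟨i, hi, hmin⟩ := hwf.has_min S ⟨j, hj⟩
  have hiI : i ∉ I := fun h => by
    obtain ⟨j, hj, hji⟩ := hcross i h
    exact hmin j hj hji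
  refine ⟨i, ?_, fun j hj => ?_⟩
  · have h0 : G.arrowExp I Iᶜ i = 0 := by simp [hiI]
    rw [h0]
    exact Nat.pos_of_ne_zero fun h => hi (h.trans h0.symm)
  · by_contra h
    exact hmin j h hj

variable (K) in
/-- The monomials of a polynomial graded by the Picard group. -/
noncomputable def toPicard (G : Multigraph V) :
    MvPolynomial V K →ₐ[K] AddMonoidAlgebra K ((V → ℤ) ⧸ G.laplacianLattice) :=
  aeval fun i => AddMonoidAlgebra.single (QuotientAddGroup.mk (Pi.single i 1)) 1

theorem toPicard_monomial (G : Multigraph V) (a : V →₀ ℕ) (c : K) :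
    G.toPicard K (monomial a c) =
      AddMonoidAlgebra.single (QuotientAddGroup.mk fun i => (a i : ℤ)) c := by
  have h : (∑ i, a i • Pi.single i (1 : ℤ) : V → ℤ) = fun i => (a i : ℤ) := by
    ext j
    simp [Finset.sum_apply, Pi.single_apply]
  rw [toPicard, aeval_monomial, Finsupp.prod_fintype _ _ (by simp), ← h]
  have h2 : ∀ s : Finset V, (∏ i ∈ s, (AddMonoidAlgebra.single (QuotientAddGroup.mk
      (Pi.single i 1)) 1 : AddMonoidAlgebra K ((V → ℤ) ⧸ G.laplacianLattice)) ^ a i) =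
      AddMonoidAlgebra.single (QuotientAddGroup.mk (∑ i ∈ s, a i • Pi.single i (1 : ℤ))) 1 := by
    intro s
    induction s using Finset.induction_on with
    | empty => simp [AddMonoidAlgebra.one_def]
    | insert i s hi ih =>
      rw [Finset.prod_insert hi, Finset.sum_insert hi, ih, AddMonoidAlgebra.single_pow,
        AddMonoidAlgebra.single_mul_single, one_pow, one_mul]
      rfl
  rw [h2, AddMonoidAlgebra.coe_algebraMap, Function.comp_apply, AddMonoidAlgebra.single_mul_single,
    zero_add, mul_one, Algebra.algebraMap_self_apply]

/-- `toPicard` adds up the coefficients within each class of exponents modulo the lattice, so it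
kills the generating binomials. -/
theorem toPicard_eq_zero (G : Multigraph V) {f : MvPolynomial V K}
    (hf : f ∈ G.topplingIdeal K) : G.toPicard K f = 0 := by
  have : G.topplingIdeal K ≤ RingHom.ker (G.toPicard K) := by
    refine Ideal.span_le.2 ?_
    rintro f ⟨a, b, hab, rfl⟩
    have : (QuotientAddGroup.mk fun i => (a i : ℤ) : (V → ℤ) ⧸ G.laplacianLattice) =
        QuotientAddGroup.mk fun i => (b i : ℤ) := by
      rw [eq_comm, QuotientAddGroup.eq]
      convert hab using 1
      ext i
      simp [sub_eq_neg_add]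
    simp only [SetLike.mem_coe, RingHom.mem_ker, map_sub, toPicard_monomial, this, sub_self]
  exact this hf

/-- Every monomial of a polynomial in the toppling ideal is equivalent to another one. -/
theorem exists_ne_mem_support (G : Multigraph V) {f : MvPolynomial V K}
    (hf : f ∈ G.topplingIdeal K) {a : V →₀ ℕ} (ha : a ∈ f.support) :
    ∃ b ∈ f.support, b ≠ a ∧ (fun i => (a i : ℤ) - b i) ∈ G.laplacianLattice := by
  classical
  by_contra hc
  push Not at hc
  have h0 := G.toPicard_eq_zero hf
  rw [f.as_sum, map_sum] at h0
  have h1 := congrArg (fun x => x.coeff (QuotientAddGroup.mk fun i => (a i : ℤ))) h0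
  simp only [toPicard_monomial, AddMonoidAlgebra.coeff_sum, AddMonoidAlgebra.coeff_single,
    Finsupp.coe_finsetSum, Finset.sum_apply, Finsupp.single_apply] at h1
  rw [Finset.sum_eq_single a] at h1
  · simp only [if_true] at h1
    exact mem_support_iff.1 ha h1
  · intro b hb hba
    rw [if_neg]
    intro h
    refine hc b hb hba ?_
    rw [QuotientAddGroup.eq] at h
    convert h using 1
    ext i
    simp [sub_eq_neg_add]
  · intro h; exact absurd ha h

/-- A monomial that is not minimal in its class lies in `M_G`. -/
theorem exists_arrowExp_le {G : Multigraph V} {q : V} {m : MonomialOrder.{u, w} V}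
    (hm : ∀ I : Finset V, I.Nonempty → q ∉ I →
      m.toSyn (G.arrowExp Iᶜ I) < m.toSyn (G.arrowExp I Iᶜ)) {a b : V →₀ ℕ}
    (hba : m.toSyn b < m.toSyn a) (hab : (fun i => (a i : ℤ) - b i) ∈ G.laplacianLattice) :
    ∃ I : Finset V, I.Nonempty ∧ q ∉ I ∧ G.arrowExp I Iᶜ ≤ a := by
  have : Nonempty V := ⟨q⟩
  have hwf : WellFounded fun x y : V →₀ ℕ => m.toSyn x < m.toSyn y :=
    InvImage.wf m.toSyn wellFounded_lt
  -- The script `c` from `a` to the minimal monomial `b'` of the class is better suited than one to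
  -- `b`: if its maxima include `q`, minimality is contradicted by firing backwards.
  obtain ⟨b', hb', hmin⟩ := hwf.has_min
    {x : V →₀ ℕ | (fun i => (a i : ℤ) - x i) ∈ G.laplacianLattice} ⟨b, hab⟩
  have hlt : m.toSyn b' < m.toSyn a := lt_of_le_of_lt (not_lt.1 (hmin b hab)) hba
  obtain ⟨c, hc⟩ := G.mem_laplacianLattice_iff.1 hb'
  by_cases hq : q ∈ argmax c
  · exfalso
    have hcn : ∀ i, G.laplacian.mulVec (-c) i = (b' i : ℤ) - a i := by
      intro i
      rw [Matrix.mulVec_neg, Pi.neg_apply, congrFun hc i, neg_sub]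
    have hle := G.arrowExp_le_of_sub_eq hcn
    -- The minima of `c` can be fired at `b'`. They avoid `q` unless `c` is constant, which would
    -- give `a = b'`; firing them then yields a monomial of the class smaller than `b'`.
    set I := argmax (-c) with hI
    have hqI : q ∉ I := by
      intro hqI
      have hconst : ∀ i, c i = c q := fun i => by
        have h1 := mem_argmax.1 hq i
        have h2 := mem_argmax.1 hqI i
        simp only [Pi.neg_apply] at h2
        omega
      refine hlt.ne (congrArg _ (Finsupp.ext fun i => ?_))
      have h3 := congrFun hc i
      rw [laplacian_mulVec_apply, Finset.sum_eq_zero fun k _ => by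
        rw [hconst i, hconst k, sub_self, mul_zero]] at h3
      omega
    obtain ⟨x, hdec⟩ := exists_add_of_le hle
    rw [add_comm] at hdec
    refine hmin (x + G.arrowExp Iᶜ I) ?_ ?_
    · refine G.mem_laplacianLattice_iff.2 ⟨c + ind I, ?_⟩
      ext i
      have h1 := DFunLike.congr_fun hdec i
      rw [Finsupp.add_apply] at h1
      rw [Matrix.mulVec_add, Pi.add_apply, laplacian_mulVec_ind, congrFun hc i, Finsupp.add_apply]
      push_cast
      omega
    · conv_rhs => rw [hdec]
      rw [map_add, map_add]
      exact add_lt_add_right (hm I (argmax_nonempty _) hqI) _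
  · exact ⟨argmax c, argmax_nonempty c, hq, G.arrowExp_le_of_sub_eq fun i => congrFun hc i⟩

theorem leadingTerm_arrow_sub_arrow {G : Multigraph V} {m : MonomialOrder.{u, w} V}
    {I J : Finset V} (h : m.toSyn (G.arrowExp J I) < m.toSyn (G.arrowExp I J)) :
    m.leadingTerm (G.arrow K I J - G.arrow K J I) = G.arrow K I J := by
  have hlt : m.toSyn (m.degree (G.arrow K J I)) < m.toSyn (m.degree (G.arrow K I J)) := by
    classical
    simpa [arrow, MonomialOrder.degree_monomial] using h
  rw [MonomialOrder.leadingTerm, MonomialOrder.degree_sub_of_lt hlt,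
    MonomialOrder.leadingCoeff_sub_of_lt hlt]
  exact m.leadingTerm_monomial _ _

/-- The leading terms of the binomials, the initial ideal and `M_G` are compared in a cycle of three
inclusions, so all three ideals coincide. The only property of the order needed is which monomial
leads in a split binomial. -/
theorem Connected.initialIdeal_topplingIdeal {G : Multigraph V} (hG : G.Connected) {q : V}
    {m : MonomialOrder.{u, w} V}
    (hm : ∀ I : Finset V, I.Nonempty → q ∉ I →
      m.toSyn (G.arrowExp Iᶜ I) < m.toSyn (G.arrowExp I Iᶜ)) :
    IsGroebnerBasis m (G.connectedSplitBinomials K) (G.topplingIdeal K) ∧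
      initialIdeal m (G.topplingIdeal K) = G.parkingIdeal K q := by
  have hsub : G.connectedSplitBinomials K ⊆ G.topplingIdeal K := by
    rw [hG.topplingIdeal_eq_span]; exact Ideal.subset_span
  have h1 : Ideal.span (m.leadingTerm '' G.connectedSplitBinomials K) ≤
      initialIdeal m (G.topplingIdeal K) := Ideal.span_mono (Set.image_mono hsub)
  have hdvd : ∀ {a b : V →₀ ℕ} (c : K) {J : Ideal (MvPolynomial V K)}, a ≤ b →
      (monomial a 1 : MvPolynomial V K) ∈ J → monomial b c ∈ J := by
    intro a b c J hab ha
    have := J.mul_mem_left (monomial (b - a) c) ha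
    rwa [monomial_mul, tsub_add_cancel_of_le hab, mul_one] at this
  have h2 : initialIdeal m (G.topplingIdeal K) ≤ G.parkingIdeal K q := by
    refine Ideal.span_le.2 ?_
    rintro _ ⟨f, hf, rfl⟩
    rcases eq_or_ne f 0 with rfl | hf0
    · simp
    obtain ⟨b, hb, hne, hbL⟩ := G.exists_ne_mem_support hf (m.degree_mem_support hf0)
    have hlt : m.toSyn b < m.toSyn (m.degree f) :=
      lt_of_le_of_ne (m.le_degree hb) fun h => hne (m.toSyn.injective h)
    obtain ⟨I, hI, hq, hle⟩ := exists_arrowExp_le hm hlt hbL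
    exact hdvd _ hle (Ideal.subset_span ⟨I, hI, hq, rfl⟩)
  have h3 : G.parkingIdeal K q ≤ Ideal.span (m.leadingTerm '' G.connectedSplitBinomials K) := by
    refine Ideal.span_le.2 ?_
    rintro _ ⟨I, hI, hq, rfl⟩
    obtain ⟨D, hD, hqD, hD1, hD2, hle⟩ := hG.exists_connected_arrowExp_le q _ I rfl hI hq
    refine hdvd _ hle (Ideal.subset_span ⟨_, ⟨D, Dᶜ, ?_, hD1, hD2, rfl⟩, ?_⟩)
    · exact isSplit_compl hD ⟨q, Finset.mem_compl.2 hqD⟩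
    · exact leadingTerm_arrow_sub_arrow (hm D hD hqD)
  exact ⟨⟨hsub, le_antisymm h1 (h2.trans h3)⟩, le_antisymm h2 (h3.trans h1)⟩

end Multigraph

/-! ### Chains of lists -/

namespace ListChain

variable {W : Type v} {K : Type w} [Field K]

/-- Prepend a vertex to all lists of a chain. -/
noncomputable def cons (a : W) : (List W →₀ K) →ₗ[K] (List W →₀ K) :=
  Finsupp.lmapDomain K K (List.cons a)

@[simp]
theorem cons_single (a : W) (l : List W) (c : K) :
    cons a (Finsupp.single l c) = Finsupp.single (a :: l) c := Finsupp.mapDomain_single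

variable (K) in
/-- The simplicial boundary of a list. -/
noncomputable def bdList : List W → (List W →₀ K)
  | [] => 0
  | a :: l => Finsupp.single l 1 - cons a (bdList l)

/-- The simplicial boundary map on chains of lists. -/
noncomputable def bd : (List W →₀ K) →ₗ[K] (List W →₀ K) := Finsupp.linearCombination K (bdList K)

theorem bd_single (l : List W) : bd (Finsupp.single l 1) = bdList K l := by simp [bd]

/-- Cone formula, the basis of all inductions on lists. The boundary of a one-element list is the
empty list, so the chain complex is augmented. -/
theorem bd_cons (a : W) (x : List W →₀ K) : bd (cons a x) = x - cons a (bd x) := by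
  have : bd ∘ₗ cons a = LinearMap.id - cons a ∘ₗ (bd : (List W →₀ K) →ₗ[K] _) := by
    refine Finsupp.lhom_ext' fun l => LinearMap.ext_ring ?_
    simp [bd, bdList]
  exact LinearMap.congr_fun this x

theorem bd_bdList (l : List W) : bd (bdList K l) = 0 := by
  induction l with
  | nil => simp [bdList]
  | cons a l ih => simp [bdList, bd_cons, ih, bd_single]

/-- The prism over a list for a homotopy from `f` to `g`. -/
noncomputable def prismList (f g : W → W) : List W → (List W →₀ K)
  | [] => 0
  | a :: l => Finsupp.single (f a :: g a :: l.map g) 1 - cons (f a) (prismList f g l)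

/-- The prism operator for a homotopy from `f` to `g`. -/
noncomputable def prism (f g : W → W) : (List W →₀ K) →ₗ[K] (List W →₀ K) :=
  Finsupp.linearCombination K (prismList f g)

theorem prism_single (f g : W → W) (l : List W) :
    prism f g (Finsupp.single l (1 : K)) = prismList f g l := by simp [prism]

theorem prism_cons (f g : W → W) (a : W) (x : List W →₀ K) :
    prism f g (cons a x) = cons (f a) (cons (g a) (Finsupp.lmapDomain K K (List.map g) x)) -
      cons (f a) (prism f g x) := by
  have : prism f g ∘ₗ cons a = cons (f a) ∘ₗ cons (g a) ∘ₗ Finsupp.lmapDomain K K (List.map g) -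
      cons (f a) ∘ₗ (prism f g : (List W →₀ K) →ₗ[K] _) := by
    refine Finsupp.lhom_ext' fun l => LinearMap.ext_ring ?_
    simp [prism, prismList]
  exact LinearMap.congr_fun this x

theorem map_bdList (g : W → W) (l : List W) :
    Finsupp.lmapDomain K K (List.map g) (bdList K l) = bdList K (l.map g) := by
  induction l with
  | nil => simp [bdList]
  | cons a l ih =>
    have h : ∀ x : List W →₀ K, Finsupp.lmapDomain K K (List.map g) (cons a x) =
        cons (g a) (Finsupp.lmapDomain K K (List.map g) x) := by
      intro x
      have : Finsupp.lmapDomain K K (List.map g) ∘ₗ cons a =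
          cons (g a) ∘ₗ Finsupp.lmapDomain K K (List.map g) := by
        refine Finsupp.lhom_ext' fun l => LinearMap.ext_ring ?_
        simp
      exact LinearMap.congr_fun this x
    simp only [bdList, map_sub, h, ih, List.map_cons]
    simp

/-- Induction on the list: the cone formula peels off the first vertex, and the remaining terms are
the induction hypothesis coned with `f a`. -/
theorem prism_homotopy (f g : W → W) (l : List W) :
    bd (prismList f g l) + prism f g (bdList K l) =
      Finsupp.single (l.map g) 1 - Finsupp.single (l.map f) 1 := by
  induction l with
  | nil => simp [bdList, prismList]
  | cons a l ih =>
    rw [prismList, bdList, map_sub, map_sub, bd_cons, prism_cons, bd_single, prism_single,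
      map_bdList, bdList, bdList]
    have := congrArg (cons (f a)) ih
    simp only [map_add, map_sub, cons_single] at this
    simp only [map_sub, cons_single, List.map_cons]
    rw [← sub_eq_zero] at this ⊢
    rw [← this]
    abel

/-- The lists with `n` entries, all satisfying `P`, that are weakly increasing for `R`. -/
def good (R : W → W → Prop) (P : W → Prop) (n : ℕ) : Set (List W) :=
  {l | l.length = n ∧ l.Pairwise R ∧ ∀ x ∈ l, P x}

theorem cons_mem_supported {S T : Set (List W)} {a : W} (h : ∀ l ∈ S, a :: l ∈ T)
    {x : List W →₀ K} (hx : x ∈ Finsupp.supported K K S) : cons a x ∈ Finsupp.supported K K T := by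
  rw [Finsupp.supported_eq_span_single] at hx
  induction hx using Submodule.span_induction with
  | mem x hx =>
    obtain ⟨l, hl, rfl⟩ := hx
    rw [cons_single]
    exact Finsupp.single_mem_supported K _ (h l hl)
  | zero => simp
  | add x y _ _ hx hy => rw [map_add]; exact add_mem hx hy
  | smul c x _ hx => rw [map_smul]; exact Submodule.smul_mem _ _ hx

theorem bdList_mem_supported_sublist (l : List W) :
    bdList K l ∈ Finsupp.supported K K {l' | l'.Sublist l ∧ l'.length + 1 = l.length} := by
  induction l with
  | nil => exact zero_mem _
  | cons a l ih =>
    refine sub_mem (Finsupp.single_mem_supported K _ (And.intro (List.sublist_cons_self a l) rfl))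
      (cons_mem_supported (fun l' hl' => And.intro (hl'.1.cons_cons a) ?_) ih)
    simp [hl'.2]

theorem bdList_mem_supported_good {R : W → W → Prop} {P : W → Prop} {n : ℕ} {l : List W}
    (hl : l ∈ good R P (n + 1)) : bdList K l ∈ Finsupp.supported K K (good R P n) := by
  refine Finsupp.supported_mono (fun l' hl' => ?_) (bdList_mem_supported_sublist l)
  refine ⟨?_, hl.2.1.sublist hl'.1, fun x hx => hl.2.2 x (hl'.1.subset hx)⟩
  have h1 := hl.1
  have h2 := hl'.2
  omega

/-- Degenerate lists span a subcomplex: in an increasing list equal entries are adjacent, and the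
two faces deleting one of them cancel. This makes it harmless for a deformation to identify
vertices. -/
theorem bdList_mem_supported_not_nodup [PartialOrder W] {l : List W} (h : l.Pairwise (· ≤ ·))
    (hd : ¬ l.Nodup) : bdList K l ∈ Finsupp.supported K K {l' : List W | ¬ l'.Nodup} := by
  have hc : ∀ (a : W) (l : List W), ¬ l.Nodup → ¬ (a :: l).Nodup := fun a l hl h' =>
    hl (List.nodup_cons.1 h').2
  induction l with
  | nil => simp at hd
  | cons a l ih =>
    rw [List.pairwise_cons] at h
    by_cases hl : l.Nodup
    · have ha : a ∈ l := by
        by_contra ha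
        exact hd (List.nodup_cons.2 ⟨ha, hl⟩)
      obtain _ | ⟨c, l⟩ := l
      · simp at ha
      have hac : a = c := by
        rcases List.mem_cons.1 ha with rfl | ha'
        · rfl
        · exact le_antisymm (h.1 c List.mem_cons_self) ((List.pairwise_cons.1 h.2).1 a ha')
      subst hac
      simp only [bdList, map_sub, cons_single, sub_sub_cancel]
      refine cons_mem_supported (S := {l | a ∈ l}) (fun l' hl' => ?_)
        (cons_mem_supported (S := Set.univ) (fun l' _ => List.mem_cons_self) (by simp))
      exact fun h' => (List.nodup_cons.1 h').1 hl'
    · exact sub_mem (Finsupp.single_mem_supported K _ hl)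
        (cons_mem_supported (hc a) (ih h.2 hl))

theorem bdList_ofFn {n : ℕ} (f : Fin (n + 1) → W) :
    bdList K (List.ofFn f) =
      ∑ j : Fin (n + 1), (-1 : K) ^ (j : ℕ) • Finsupp.single (List.ofFn (f ∘ j.succAbove)) 1 := by
  induction n with
  | zero => simp [bdList]
  | succ n ih =>
    rw [List.ofFn_succ, bdList, ih, Fin.sum_univ_succ (n := n + 1), map_sum, sub_eq_add_neg,
      ← Finset.sum_neg_distrib]
    congr 1
    · simp [Function.comp_def]
    · refine Finset.sum_congr rfl fun j _ => ?_
      rw [map_smul, cons_single, List.ofFn_succ (f := f ∘ j.succ.succAbove)]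
      simp [Function.comp_def, pow_succ]

/-- The elements satisfying `P` can be deformed to a point by finitely many elementary
homotopies. -/
def IsContractible (R : W → W → Prop) (P : W → Prop) : Prop :=
  ∃ (m : W) (N : ℕ) (g : ℕ → W → W), (∀ x, P x → g N x = x) ∧ (∀ x, P x → g 0 x = m) ∧
    (∀ c x, P x → P (g c x)) ∧
    ∀ c x y, P x → P y → R x y → R (g c x) (g c y) ∧ R (g (c + 1) x) (g c y)

theorem prismList_mem_supported {R : W → W → Prop} {P : W → Prop} (hR : ∀ x, R x x) {f g : W → W}
    (hf : ∀ x, P x → P (f x)) (hg : ∀ x, P x → P (g x))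
    (h : ∀ x y, P x → P y → R x y → R (f x) (f y) ∧ R (f x) (g y) ∧ R (g x) (g y))
    {n : ℕ} {l : List W} (hl : l ∈ good R P n) :
    prismList f g l ∈ Finsupp.supported K K (good R P (n + 1)) := by
  -- The induction must remember that each entry is an image under `f` or `g` of an entry of `l`, in
  -- order to compare it with the new first vertex.
  suffices H : ∀ l : List W, l.Pairwise R → (∀ x ∈ l, P x) →
      (prismList f g l : List W →₀ K) ∈ Finsupp.supported K K {l' | l'.length = l.length + 1 ∧
        l'.Pairwise R ∧ ∀ x ∈ l', ∃ y ∈ l, x = f y ∨ x = g y} by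
    refine Finsupp.supported_mono ?_ (H l hl.2.1 hl.2.2)
    rintro l' hl'
    refine ⟨hl.1 ▸ hl'.1, hl'.2.1, fun x hx => ?_⟩
    obtain ⟨y, hy, rfl | rfl⟩ := hl'.2.2 x hx
    · exact hf _ (hl.2.2 y hy)
    · exact hg _ (hl.2.2 y hy)
  intro l hl hP
  induction l with
  | nil => exact zero_mem _
  | cons a l ih =>
    rw [List.pairwise_cons] at hl
    have hPa : P a := hP a List.mem_cons_self
    have hPl : ∀ x ∈ l, P x := fun x hx => hP x (List.mem_cons_of_mem a hx)
    refine sub_mem (Finsupp.single_mem_supported K _ (And.intro (by simp) ⟨?_, ?_⟩))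
      (cons_mem_supported (fun l' hl' => And.intro (by simp [hl'.1]) ⟨?_, ?_⟩) (ih hl.2 hPl))
    · refine List.pairwise_cons.2 ⟨fun x hx => ?_, List.pairwise_cons.2 ⟨fun x hx => ?_, ?_⟩⟩
      · rcases List.mem_cons.1 hx with rfl | hx
        · exact (h a a hPa hPa (hR a)).2.1
        · obtain ⟨y, hy, rfl⟩ := List.mem_map.1 hx
          exact (h a y hPa (hPl y hy) (hl.1 y hy)).2.1
      · obtain ⟨y, hy, rfl⟩ := List.mem_map.1 hx
        exact (h a y hPa (hPl y hy) (hl.1 y hy)).2.2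
      · rw [List.pairwise_map]
        exact hl.2.imp_of_mem fun {x y} hx hy hxy => (h x y (hPl x hx) (hPl y hy) hxy).2.2
    · intro x hx
      rcases List.mem_cons.1 hx with rfl | hx
      · exact ⟨a, List.mem_cons_self, Or.inl rfl⟩
      rcases List.mem_cons.1 hx with rfl | hx
      · exact ⟨a, List.mem_cons_self, Or.inr rfl⟩
      · obtain ⟨y, hy, rfl⟩ := List.mem_map.1 hx
        exact ⟨y, List.mem_cons_of_mem a hy, Or.inr rfl⟩
    · refine List.pairwise_cons.2 ⟨fun x hx => ?_, hl'.2.1⟩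
      obtain ⟨y, hy, rfl | rfl⟩ := hl'.2.2 x hx
      · exact (h a y hPa (hPl y hy) (hl.1 y hy)).1
      · exact (h a y hPa (hPl y hy) (hl.1 y hy)).2.1
    · intro x hx
      rcases List.mem_cons.1 hx with rfl | hx
      · exact ⟨a, List.mem_cons_self, Or.inl rfl⟩
      · obtain ⟨y, hy, hxy⟩ := hl'.2.2 x hx
        exact ⟨y, List.mem_cons_of_mem a hy, hxy⟩

/-- The prisms of the successive elementary homotopies add up to one from the identity to the
constant map. -/
theorem IsContractible.exists_homotopy {R : W → W → Prop} {P : W → Prop} (hR : ∀ x, R x x)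
    (h : IsContractible R P) : ∃ (m : W) (H : (List W →₀ K) →ₗ[K] (List W →₀ K)),
      H (Finsupp.single [] 1) = 0 ∧ ∀ n, ∀ l ∈ good R P n,
        H (Finsupp.single l 1) ∈ Finsupp.supported K K (good R P (n + 1)) ∧
        bd (H (Finsupp.single l 1)) + H (bdList K l) =
          Finsupp.single (List.replicate n m) 1 - Finsupp.single l 1 := by
  obtain ⟨m, N, g, hN, h0, hP, hg⟩ := h
  refine ⟨m, ∑ c ∈ Finset.range N, prism (g (c + 1)) (g c), ?_, fun n l hl => ⟨?_, ?_⟩⟩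
  · simp [LinearMap.sum_apply, prism_single, prismList]
  · rw [LinearMap.sum_apply]
    refine sum_mem fun c _ => ?_
    rw [prism_single]
    exact prismList_mem_supported hR (hP _) (hP _) (fun x y hx hy hxy =>
      ⟨(hg (c + 1) x y hx hy hxy).1, (hg c x y hx hy hxy).2, (hg c x y hx hy hxy).1⟩) hl
  · simp only [LinearMap.sum_apply, map_sum, ← Finset.sum_add_distrib, prism_single, prism_homotopy]
    -- The sum telescopes to the difference between the images of `l` under `g 0` and `g N`.
    rw [Finset.sum_range_sub' (fun c => (Finsupp.single (l.map (g c)) 1 : List W →₀ K))]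
    have e1 : l.map (g N) = l :=
      (List.map_congr_left fun x hx => hN x (hl.2.2 x hx)).trans (List.map_id' l)
    have e2 : l.map (g 0) = List.replicate n m := by
      rw [List.map_congr_left fun x hx => h0 x (hl.2.2 x hx), List.map_const', hl.1]
    rw [e1, e2]

end ListChain

/-! ### Laurent monomials -/

namespace Laurent

variable {V : Type u} {K : Type v} [Field K]

theorem mono_mul_mono (a b : V → ℤ) : (mono K a * mono K b : Laurent V K) = mono K (a + b) :=
  (AddMonoidAlgebra.single_mul_single a b (1 : K) 1).trans (by rw [one_mul]; rfl)

theorem mono_zero : (mono K 0 : Laurent V K) = 1 := rfl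

instance [DecidableEq V] : IsScalarTower K (MvPolynomial V K) (Laurent V K) :=
  IsScalarTower.of_algebraMap_eq fun c => by
    rw [RingHom.algebraMap_toAlgebra]
    exact ((MvPolynomial.aeval (R := K) fun i : V => mono K (Pi.single i 1)).commutes c).symm

theorem algebraMap_monomial [Fintype V] [DecidableEq V] (u : V →₀ ℕ) :
    algebraMap (MvPolynomial V K) (Laurent V K) (monomial u 1) = mono K fun i => (u i : ℤ) := by
  have h : (∑ i, u i • Pi.single i (1 : ℤ) : V → ℤ) = fun i => (u i : ℤ) := by
    ext j
    simp [Finset.sum_apply, Pi.single_apply]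
  have hpow : ∀ (n : ℕ) (a : V → ℤ), (mono K a : Laurent V K) ^ n = mono K (n • a) := by
    intro n a
    induction n with
    | zero => rw [pow_zero, zero_smul, mono_zero]
    | succ n ih => rw [pow_succ, ih, mono_mul_mono, succ_nsmul]
  have h2 : ∀ s : Finset V, (∏ i ∈ s, (mono K (Pi.single i 1) : Laurent V K) ^ u i) =
      mono K (∑ i ∈ s, u i • Pi.single i (1 : ℤ)) := by
    intro s
    induction s using Finset.induction_on with
    | empty => simp [mono_zero]
    | insert i s hi ih =>
      rw [Finset.prod_insert hi, Finset.sum_insert hi, ih, hpow, mono_mul_mono]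
  rw [RingHom.algebraMap_toAlgebra]
  refine (aeval_monomial _ _ _).trans ?_
  rw [map_one, one_mul, Finsupp.prod_fintype _ _ (by simp), h2, h]

variable (V K) in
/-- The basis of Laurent monomials. -/
noncomputable def monoBasis : Module.Basis (V → ℤ) K (Laurent V K) :=
  .ofRepr (AddMonoidAlgebra.coeffLinearEquiv K)

theorem monoBasis_apply (a : V → ℤ) : monoBasis V K a = mono K a := rfl

end Laurent

/-! ### Cellular resolutions -/

/-- The exponent vector with the given nonnegative coordinates. -/
noncomputable def toExp {V : Type u} [Fintype V] (a : V → ℤ) : V →₀ ℕ :=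
  Finsupp.equivFunOnFinite.symm fun i => (a i).toNat

@[simp]
theorem toExp_apply {V : Type u} [Fintype V] (a : V → ℤ) (i : V) : toExp a i = (a i).toNat := rfl

@[simp]
theorem toExp_natCast {V : Type u} [Fintype V] (a : V →₀ ℕ) : (toExp fun i => (a i : ℤ)) = a := by
  ext i
  simp

/-- The monomial multiples of the standard basis vectors form a vector space basis. -/
noncomputable def monomialBasis (V : Type u) (K : Type v) [Field K] (B : Type w) :
    Module.Basis (Σ _ : B, (V →₀ ℕ)) K (B →₀ MvPolynomial V K) :=
  Finsupp.basis fun _ => basisMonomials V K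

theorem monomialBasis_apply {V : Type u} {K : Type v} [Field K] {B : Type w} (b : B)
    (a : V →₀ ℕ) : monomialBasis V K B ⟨b, a⟩ = Finsupp.single b (monomial a 1) := by
  rw [monomialBasis, Finsupp.coe_basis]
  simp

theorem monomial_basis_hom_ext {V : Type u} {K : Type v} [Field K] {B : Type w} {M : Type*}
    [AddCommGroup M] [Module K M] {f g : (B →₀ MvPolynomial V K) →ₗ[K] M}
    (h : ∀ b a, f (Finsupp.single b (monomial a 1)) = g (Finsupp.single b (monomial a 1))) :
    f = g :=
  (monomialBasis V K B).ext fun ⟨b, a⟩ => by rw [monomialBasis_apply]; exact h b a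

namespace LabeledComplex

variable {V : Type u} {W : Type v} [PartialOrder W] (X : LabeledComplex V W)
  {K : Type w} [Field K] {k : ℕ}

variable {X} in
theorem Face.label_le_iff (σ : X.Face k) {b : V → ℤ} :
    σ.label ≤ b ↔ ∀ t, X.label (σ.1 t) ≤ b := by
  simp [Face.label]

variable {X} in
theorem Face.label_delete_le (σ : X.Face (k + 1)) (j : Fin (k + 2)) :
    (σ.delete j).label ≤ σ.label :=
  (σ.delete j).label_le_iff.2 fun t => σ.label_le_iff.1 le_rfl (j.succAbove t)

variable {X} in
theorem Face.ofFn_injective : Function.Injective fun σ : X.Face k => List.ofFn σ.1 := by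
  intro σ τ h
  ext t
  exact congrFun (List.ofFn_injective h) t

/-- The faces of `X` are the finite nonempty sets whose elements are pairwise related by the
relation `R`, which refines the order. -/
structure IsFlag (X : LabeledComplex V W) (R : W → W → Prop) : Prop where
  refl : ∀ x, R x x
  le : ∀ x y, R x y → x ≤ y
  mem_faces_iff : ∀ s : Finset W, s.Nonempty → (s ∈ X.faces ↔ ∀ x ∈ s, ∀ y ∈ s, R x y ∨ R y x)

variable {X} {R : W → W → Prop} in
theorem IsFlag.pairwise_ofFn (hR : X.IsFlag R) (σ : X.Face k) : (List.ofFn σ.1).Pairwise R := by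
  rw [List.pairwise_ofFn]
  intro i j hij
  have h := (hR.mem_faces_iff _ Finset.univ_nonempty.map).1 σ.2 (σ.1 i) (by simp) (σ.1 j) (by simp)
  rcases h with h | h
  · exact h
  · exact absurd (σ.1.le_iff_le.1 (hR.le _ _ h)) (not_le.2 hij)

variable {X} {R : W → W → Prop} in
theorem IsFlag.exists_ofFn_eq (hR : X.IsFlag R) {l : List W} (hl : l.length = k + 1)
    (hp : l.Pairwise R) (hd : l.Nodup) : ∃ σ : X.Face k, List.ofFn σ.1 = l := by
  obtain ⟨f, rfl⟩ : ∃ f : Fin (k + 1) → W, List.ofFn f = l := by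
    exact ⟨fun t => l.get (t.cast hl.symm), List.ext_get (by simp [hl]) fun n h₁ h₂ => by
      simp only [List.get_ofFn]; rfl⟩
  rw [List.pairwise_ofFn] at hp
  rw [List.nodup_ofFn] at hd
  have hmono : StrictMono f := fun i j hij =>
    lt_of_le_of_ne (hR.le _ _ (hp hij)) (hd.ne hij.ne)
  refine ⟨⟨OrderEmbedding.ofStrictMono f hmono, ?_⟩, rfl⟩
  refine (hR.mem_faces_iff _ Finset.univ_nonempty.map).2 fun x hx y hy => ?_
  simp only [Finset.mem_map, Finset.mem_univ, true_and] at hx hy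
  obtain ⟨i, rfl⟩ := hx
  obtain ⟨j, rfl⟩ := hy
  rcases lt_trichotomy i j with h | rfl | h
  · exact Or.inl (hp h)
  · exact Or.inl (hR.refl _)
  · exact Or.inr (hp h)

variable {X} {R : W → W → Prop} in
theorem IsFlag.ofFn_mem_good (hR : X.IsFlag R) {b : V → ℤ} (σ : X.Face k) (h : σ.label ≤ b) :
    List.ofFn σ.1 ∈ ListChain.good R (fun w => X.label w ≤ b) (k + 1) := by
  refine ⟨List.length_ofFn, hR.pairwise_ofFn σ, fun x hx => ?_⟩
  obtain ⟨t, rfl⟩ := List.mem_ofFn.1 hx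
  exact σ.label_le_iff.1 h t

variable {X} {R : W → W → Prop} in
theorem IsFlag.exists_face_of_mem_good (hR : X.IsFlag R) {b : V → ℤ} {l : List W}
    (hl : l ∈ ListChain.good R (fun w => X.label w ≤ b) (k + 1)) (hd : l.Nodup) :
    ∃ σ : X.Face k, List.ofFn σ.1 = l ∧ σ.label ≤ b := by
  obtain ⟨σ, rfl⟩ := hR.exists_ofFn_eq hl.1 hl.2.1 hd
  exact ⟨σ, rfl, σ.label_le_iff.2 fun t => hl.2.2 _ (List.mem_ofFn.2 ⟨t, rfl⟩)⟩

theorem range_cellularAug [DecidableEq V] (X : LabeledComplex V W) :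
    LinearMap.range (X.cellularAug K) =
      Submodule.span (MvPolynomial V K) (Set.range fun w => Laurent.mono K (X.label w)) := by
  rw [cellularAug, Finsupp.range_linearCombination]
  congr 1
  ext f
  constructor
  · rintro ⟨σ, rfl⟩
    exact ⟨σ.1 0, by simp [Face.label]⟩
  · rintro ⟨w, rfl⟩
    let e : Fin 1 ↪o W := ⟨⟨fun _ => w, fun _ _ _ => Subsingleton.elim _ _⟩, by simp⟩
    have he : Finset.univ.map e.toEmbedding = {w} := rfl
    exact ⟨⟨e, he ▸ X.singleton_mem w⟩, rfl⟩

variable [Fintype V]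

variable (K) {X} in
/-- The basis vector of degree `b` at the face `σ`. -/
noncomputable def Face.vec (b : V → ℤ) (σ : X.Face k) : X.Face k →₀ MvPolynomial V K :=
  Finsupp.single σ (monomial (toExp (b - σ.label)) 1)

variable {X} in
theorem Face.vec_label_add (σ : X.Face k) (a : V →₀ ℕ) :
    σ.vec K (σ.label + fun i => (a i : ℤ)) = Finsupp.single σ (monomial a 1) := by
  rw [Face.vec, add_sub_cancel_left, toExp_natCast]

/-- In a fixed degree the monomial coefficients are forced, since `x^{b - a_σ}` times the label
quotient is `x^{b - a_τ}` for the facet `τ`. What remains is the simplicial boundary over `K`. -/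
theorem cellularD_vec {b : V → ℤ} (σ : X.Face (k + 1)) (h : σ.label ≤ b) :
    X.cellularD K k (σ.vec K b) =
      ∑ j : Fin (k + 2), (-1 : K) ^ (j : ℕ) • (σ.delete j).vec K b := by
  rw [Face.vec, cellularD, Finsupp.linearCombination_single, Finset.smul_sum]
  refine Finset.sum_congr rfl fun j _ => ?_
  have e : toExp (b - (σ.delete j).label) = toExp (b - σ.label) +
      Finsupp.equivFunOnFinite.symm fun i => (σ.label i - (σ.delete j).label i).toNat := by
    ext i
    have h1 : σ.label i ≤ b i := h i
    have h2 : (σ.delete j).label i ≤ σ.label i := σ.label_delete_le j i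
    simp only [toExp_apply, Finsupp.add_apply, Finsupp.equivFunOnFinite_symm_apply_apply,
      Pi.sub_apply]
    omega
  rw [Finsupp.smul_single, Face.vec, Finsupp.smul_single, e, smul_eq_mul, mul_left_comm,
    monomial_mul, one_mul]
  congr 1
  rw [Algebra.smul_def]
  simp

theorem cellularAug_vec [DecidableEq V] {b : V → ℤ} (σ : X.Face 0) (h : σ.label ≤ b) :
    X.cellularAug K (σ.vec K b) = Laurent.mono K b := by
  rw [Face.vec, cellularAug, Finsupp.linearCombination_single, Algebra.smul_def,
    Laurent.algebraMap_monomial, Laurent.mono_mul_mono]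
  congr 1
  ext i
  have : σ.label i ≤ b i := h i
  simp only [toExp_apply, Pi.add_apply, Pi.sub_apply]
  omega

variable (K) in
open Classical in
/-- The element of degree `b` of the cellular complex given by a list of vertices; it vanishes
if the list is not an increasing enumeration of a face of label at most `b`. -/
noncomputable def ofList (k : ℕ) (b : V → ℤ) (l : List W) : X.Face k →₀ MvPolynomial V K :=
  if h : ∃ σ : X.Face k, List.ofFn σ.1 = l ∧ σ.label ≤ b then h.choose.vec K b else 0

theorem ofList_ofFn {b : V → ℤ} (σ : X.Face k) (h : σ.label ≤ b) :
    X.ofList K k b (List.ofFn σ.1) = σ.vec K b := by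
  have hex : ∃ τ : X.Face k, List.ofFn τ.1 = List.ofFn σ.1 ∧ τ.label ≤ b := ⟨σ, rfl, h⟩
  rw [ofList, dif_pos hex, Face.ofFn_injective hex.choose_spec.1]

theorem ofList_of_not_nodup {b : V → ℤ} {l : List W} (h : ¬ l.Nodup) : X.ofList K k b l = 0 := by
  rw [ofList, dif_neg]
  rintro ⟨σ, rfl, -⟩
  exact h (List.nodup_ofFn.2 σ.1.injective)

variable (K) in
/-- The linear extension of `ofList`. -/
noncomputable def ofListChain (k : ℕ) (b : V → ℤ) :
    (List W →₀ K) →ₗ[K] (X.Face k →₀ MvPolynomial V K) :=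
  Finsupp.linearCombination K (X.ofList K k b)

theorem ofListChain_single {b : V → ℤ} {l : List W} :
    X.ofListChain K k b (Finsupp.single l 1) = X.ofList K k b l := by simp [ofListChain]

theorem ofListChain_bdList_ofFn {b : V → ℤ} (σ : X.Face (k + 1)) (h : σ.label ≤ b) :
    X.ofListChain K k b (ListChain.bdList K (List.ofFn σ.1)) = X.cellularD K k (σ.vec K b) := by
  rw [ListChain.bdList_ofFn, map_sum, cellularD_vec X σ h]
  refine Finset.sum_congr rfl fun j _ => ?_
  rw [map_smul, ofListChain_single, ← X.ofList_ofFn (σ.delete j) ((σ.label_delete_le j).trans h)]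
  rfl

section Flag

variable {X} {R : W → W → Prop}

/-- List chains in the sublevel complex map to the graded strand compatibly with boundaries;
degenerate lists go to zero, and so do their boundaries. -/
theorem IsFlag.cellularD_ofListChain (hR : X.IsFlag R) {b : V → ℤ} {x : List W →₀ K}
    (hx : x ∈ Finsupp.supported K K (ListChain.good R (fun w => X.label w ≤ b) (k + 2))) :
    X.cellularD K k (X.ofListChain K (k + 1) b x) = X.ofListChain K k b (ListChain.bd x) := by
  rw [Finsupp.supported_eq_span_single] at hx
  induction hx using Submodule.span_induction with
  | mem x hx =>
    obtain ⟨l, hl, rfl⟩ := hx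
    rw [ofListChain_single, ListChain.bd_single]
    by_cases hd : l.Nodup
    · obtain ⟨σ, rfl, hσ⟩ := hR.exists_face_of_mem_good hl hd
      rw [X.ofList_ofFn σ hσ, X.ofListChain_bdList_ofFn σ hσ]
    · rw [X.ofList_of_not_nodup hd, map_zero]
      have h := ListChain.bdList_mem_supported_not_nodup (K := K) (hl.2.1.imp (hR.le _ _)) hd
      have hz : Finsupp.supported K K {l' : List W | ¬ l'.Nodup} ≤
          LinearMap.ker (X.ofListChain K k b) := by
        rw [Finsupp.supported_eq_span_single, Submodule.span_le]
        rintro _ ⟨l', hl', rfl⟩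
        rw [SetLike.mem_coe, LinearMap.mem_ker, ofListChain_single, X.ofList_of_not_nodup hl']
      exact (hz h).symm
  | zero => simp
  | add x y _ _ hx hy => simp only [map_add, hx, hy]
  | smul c x _ hx =>
    rw [(X.ofListChain K (k + 1) b).map_smul, map_smul ListChain.bd, (X.ofListChain K k b).map_smul,
      ← hx]
    exact ((X.cellularD K k).restrictScalars K).map_smul c _

theorem IsFlag.cellularD_cellularD (hR : X.IsFlag R) (f : X.Face (k + 2) →₀ MvPolynomial V K) :
    X.cellularD K k (X.cellularD K (k + 1) f) = 0 := by
  suffices h : (X.cellularD K k ∘ₗ X.cellularD K (k + 1)).restrictScalars K = 0 from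
    LinearMap.congr_fun h f
  refine monomial_basis_hom_ext fun σ a => ?_
  rw [← σ.vec_label_add]
  set b := σ.label + fun i => (a i : ℤ)
  have hσ : σ.label ≤ b := le_add_of_nonneg_right fun i => by simp
  have hg := hR.ofFn_mem_good σ hσ
  change X.cellularD K k (X.cellularD K (k + 1) (σ.vec K b)) = 0
  rw [← X.ofListChain_bdList_ofFn σ hσ, hR.cellularD_ofListChain
    (ListChain.bdList_mem_supported_good hg), ListChain.bd_bdList, map_zero]

theorem cellularAug_cellularD [DecidableEq V] (X : LabeledComplex V W)
    (f : X.Face 1 →₀ MvPolynomial V K) : X.cellularAug K (X.cellularD K 0 f) = 0 := by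
  suffices h : (X.cellularAug K ∘ₗ X.cellularD K 0).restrictScalars K = 0 from
    LinearMap.congr_fun h f
  refine monomial_basis_hom_ext fun σ a => ?_
  rw [← σ.vec_label_add]
  set b := σ.label + fun i => (a i : ℤ)
  have hσ : σ.label ≤ b := le_add_of_nonneg_right fun i => by simp
  have hv : ∀ j, X.cellularAug K ((σ.delete j).vec K b) = Laurent.mono K b := fun j =>
    X.cellularAug_vec _ ((σ.label_delete_le j).trans hσ)
  have hs : ∀ (c : K) g, X.cellularAug K (c • g) = c • X.cellularAug K g := fun c g =>
    ((X.cellularAug K).restrictScalars K).map_smul c g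
  change X.cellularAug K (X.cellularD K 0 (σ.vec K b)) = 0
  rw [X.cellularD_vec σ hσ, map_sum, Fin.sum_univ_two, hs, hs, hv, hv]
  simp

/-- A flag complex all of whose sublevel complexes are contractible supports a resolution. -/
theorem IsFlag.isFreeResolution [DecidableEq V] (hR : X.IsFlag R)
    (hX : ∀ b : V → ℤ, (∃ w, X.label w ≤ b) →
      ListChain.IsContractible R fun w => X.label w ≤ b) :
    IsFreeResolution (X.cellularD K) (X.cellularAug K).rangeRestrict := by
  -- `M n` is the constant list at the centre of the contraction. From length two on it is
  -- degenerate, so it only matters in homological degree zero.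
  have hex : ∀ b : V → ℤ, ∃ (M : ℕ → List W) (H : (List W →₀ K) →ₗ[K] (List W →₀ K)),
      (∀ n, X.ofList K (n + 1) b (M (n + 2)) = 0) ∧ H (Finsupp.single [] 1) = 0 ∧
      ∀ n, ∀ l ∈ ListChain.good R (fun w => X.label w ≤ b) (n + 1),
        H (Finsupp.single l 1) ∈
          Finsupp.supported K K (ListChain.good R (fun w => X.label w ≤ b) (n + 2)) ∧
        ListChain.bd (H (Finsupp.single l 1)) + H (ListChain.bdList K l) =
          Finsupp.single (M (n + 1)) 1 - Finsupp.single l 1 := by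
    intro b
    by_cases hb : ∃ w, X.label w ≤ b
    · obtain ⟨m, H, h0, hH⟩ := (hX b hb).exists_homotopy (K := K) hR.refl
      exact ⟨fun n => List.replicate n m, H,
        fun n => X.ofList_of_not_nodup (by simp [List.replicate_succ]), h0, fun n => hH (n + 1)⟩
    -- No vertex has label at most `b`: the strand is zero and the conditions are vacuous.
    · refine ⟨fun _ => [], 0, fun n => ?_, rfl, fun n l hl => ?_⟩
      · rw [ofList, dif_neg]
        rintro ⟨σ, hσ, -⟩
        simp at hσ
      · obtain _ | ⟨x, l⟩ := l
        · simp [ListChain.good] at hl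
        · exact absurd ⟨x, hl.2.2 x List.mem_cons_self⟩ hb
  choose M H hM hH0 hH using hex
  -- The homotopies of all degrees are glued along the monomial basis. The result is only
  -- `K`-linear, since the contractions in different degrees are chosen independently; this is
  -- enough for exactness.
  let h : ∀ k, (X.Face k →₀ MvPolynomial V K) →ₗ[K] (X.Face (k + 1) →₀ MvPolynomial V K) :=
    fun k => (monomialBasis V K (X.Face k)).constr K fun p =>
      X.ofListChain K (k + 1) (p.1.label + fun i => (p.2 i : ℤ))
        (H (p.1.label + fun i => (p.2 i : ℤ)) (Finsupp.single (List.ofFn p.1.1) 1))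
  have hvec : ∀ k (σ : X.Face k) b, σ.label ≤ b →
      h k (σ.vec K b) = X.ofListChain K (k + 1) b (H b (Finsupp.single (List.ofFn σ.1) 1)) := by
    intro k σ b hb
    have e : b = σ.label + fun i => ((toExp (b - σ.label)) i : ℤ) := by
      ext i
      have : σ.label i ≤ b i := hb i
      simp only [toExp_apply, Pi.add_apply, Pi.sub_apply]
      omega
    have := (monomialBasis V K (X.Face k)).constr_basis K (fun p =>
      X.ofListChain K (k + 1) (p.1.label + fun i => (p.2 i : ℤ))
        (H (p.1.label + fun i => (p.2 i : ℤ)) (Finsupp.single (List.ofFn p.1.1) 1)))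
        ⟨σ, toExp (b - σ.label)⟩
    rw [monomialBasis_apply] at this
    simp only [← e] at this
    exact this
  have hlist : ∀ k (σ : X.Face (k + 1)) b, σ.label ≤ b → h k (X.cellularD K k (σ.vec K b)) =
      X.ofListChain K (k + 1) b (H b (ListChain.bdList K (List.ofFn σ.1))) := by
    intro k σ b hb
    rw [X.cellularD_vec σ hb, ListChain.bdList_ofFn, map_sum, map_sum, map_sum]
    refine Finset.sum_congr rfl fun j _ => ?_
    rw [map_smul, map_smul, map_smul, hvec k _ b ((σ.label_delete_le j).trans hb)]
    rfl
  have hdh : ∀ k (σ : X.Face k) b, σ.label ≤ b → X.cellularD K k (h k (σ.vec K b)) =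
      X.ofList K k b (M b (k + 1)) - σ.vec K b -
        X.ofListChain K k b (H b (ListChain.bdList K (List.ofFn σ.1))) := by
    intro k σ b hb
    have hg := hR.ofFn_mem_good σ hb
    rw [hvec k σ b hb, hR.cellularD_ofListChain (hH b k _ hg).1,
      eq_sub_of_add_eq (hH b k _ hg).2, map_sub, map_sub, ofListChain_single, ofListChain_single,
      X.ofList_ofFn σ hb]
  refine ⟨LinearMap.surjective_rangeRestrict _, fun f => ⟨fun hf => ?_, ?_⟩,
    fun k f => ⟨fun hf => ?_, ?_⟩⟩
  -- In homological degree zero the constant list survives. As `H` kills the empty list, `∂h = ηε -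
  -- id`, where `η` sends `x^b` to the central vertex in degree `b`.
  · let η : Laurent V K →ₗ[K] (X.Face 0 →₀ MvPolynomial V K) :=
      (Laurent.monoBasis V K).constr K fun b => X.ofList K 0 b (M b 1)
    have hη : ∀ b, η (Laurent.mono K b) = X.ofList K 0 b (M b 1) := fun b =>
      (Laurent.monoBasis V K).constr_basis K _ b
    have key : (X.cellularD K 0).restrictScalars K ∘ₗ h 0 =
        η ∘ₗ (X.cellularAug K).restrictScalars K - LinearMap.id := by
      refine monomial_basis_hom_ext fun σ a => ?_
      rw [← σ.vec_label_add]
      have hσ : σ.label ≤ σ.label + fun i => (a i : ℤ) := le_add_of_nonneg_right fun i => by simp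
      have h1 := hdh 0 σ _ hσ
      have h2 : ListChain.bdList K (List.ofFn σ.1) = Finsupp.single [] 1 := by
        simp [ListChain.bdList]
      rw [h2, hH0, map_zero, sub_zero] at h1
      simp only [LinearMap.comp_apply, LinearMap.sub_apply, LinearMap.restrictScalars_apply,
        LinearMap.id_apply, X.cellularAug_vec σ hσ, hη]
      exact h1
    have h1 := LinearMap.congr_fun key f
    have h2 : X.cellularAug K f = 0 := congrArg Subtype.val hf
    simp only [LinearMap.comp_apply, LinearMap.sub_apply, LinearMap.restrictScalars_apply, h2,
      map_zero, zero_sub, LinearMap.id_apply] at h1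
    exact ⟨-h 0 f, by rw [map_neg, h1, neg_neg]⟩
  · rintro ⟨g, rfl⟩
    exact Subtype.ext (X.cellularAug_cellularD g)
  -- In positive degree the constant list has gone and `∂h + h∂ = -id`, so a cycle `f` is the
  -- boundary of `-h f`.
  · have key : (X.cellularD K (k + 1)).restrictScalars K ∘ₗ h (k + 1) =
        -LinearMap.id - h k ∘ₗ (X.cellularD K k).restrictScalars K := by
      refine monomial_basis_hom_ext fun σ a => ?_
      rw [← σ.vec_label_add]
      have hσ : σ.label ≤ σ.label + fun i => (a i : ℤ) := le_add_of_nonneg_right fun i => by simp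
      have h1 := hdh (k + 1) σ _ hσ
      rw [hM, ← hlist k σ _ hσ, zero_sub] at h1
      exact h1
    have h1 := LinearMap.congr_fun key f
    simp only [LinearMap.comp_apply, LinearMap.sub_apply, LinearMap.restrictScalars_apply, hf,
      map_zero, sub_zero, LinearMap.neg_apply, LinearMap.id_apply] at h1
    exact ⟨-h (k + 1) f, by rw [map_neg, h1, neg_neg]⟩
  · rintro ⟨g, rfl⟩
    exact hR.cellularD_cellularD g

end Flag

end LabeledComplex

/-! ### Cyclically ordered partitions as chains of sets -/

namespace CyclicPartition

variable {V : Type u} {q : V} {k : ℕ}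

theorem ext_lt {p p' : CyclicPartition q k} (h : ∀ i t, p.1 i < t ↔ p'.1 i < t) : p = p' := by
  ext1
  funext i
  exact eq_of_forall_gt_iff (h i)

/-- The block of `i` is indexed by the last `t` with `i ∉ B t`. Strictness of the chain makes the
blocks nonempty, and `q`, lying in no `B t`, falls into the last one. -/
theorem exists_of_strictMono (B : Fin (k + 1) → Set V) (hB : StrictMono B) (h0 : B 0 = ∅)
    (hq : q ∉ B (Fin.last k)) : ∃ p : CyclicPartition q k, ∀ i t, i ∈ B t ↔ p.1 i < t := by
  classical
  have hne : ∀ i, (Finset.univ.filter fun t => i ∉ B t).Nonempty := fun i =>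
    ⟨0, by simp [h0]⟩
  let f : V → Fin (k + 1) := fun i => (Finset.univ.filter fun t => i ∉ B t).max' (hne i)
  have hf : ∀ i t, i ∈ B t ↔ f i < t := by
    intro i t
    constructor
    · intro hi
      by_contra hlt
      have h1 := (Finset.mem_filter.1 (Finset.max'_mem _ (hne i))).2
      exact h1 (hB.monotone (not_lt.1 hlt) hi)
    · intro hlt
      by_contra hi
      exact absurd (Finset.le_max' _ t (Finset.mem_filter.2 ⟨Finset.mem_univ t, hi⟩))
        (not_le.2 hlt)
  have hbase : f q = Fin.last k :=
    le_antisymm (Fin.le_last _) (not_lt.1 fun h => hq ((hf q _).2 h))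
  refine ⟨⟨f, fun s => ?_, hbase⟩, hf⟩
  rcases Fin.eq_castSucc_or_eq_last s with ⟨s, rfl⟩ | rfl
  · obtain ⟨i, hi, hi'⟩ := Set.exists_of_ssubset (hB s.castSucc_lt_succ)
    rw [hf] at hi hi'
    exact ⟨i, le_antisymm (Fin.le_castSucc_iff.2 hi) (not_lt.1 hi')⟩
  · exact ⟨q, hbase⟩

instance : Unique (CyclicPartition q 0) where
  default := whole q
  uniq _ := ext_lt fun i t => by simp [Subsingleton.elim (α := Fin 1) t 0]

theorem val_predAbove (s : Fin (k + 1)) (x : Fin (k + 2)) :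
    (s.predAbove x : ℕ) = if (s : ℕ) < x then (x : ℕ) - 1 else x := by
  by_cases h : s.castSucc < x
  · rw [Fin.predAbove_of_castSucc_lt _ _ h, if_pos (by simpa [Fin.lt_def] using h), Fin.val_pred]
  · rw [Fin.predAbove_of_le_castSucc _ _ (not_lt.1 h), if_neg (by simpa [Fin.lt_def] using h)]
    rfl

/-- In terms of initial unions of blocks, merging two neighbours deletes one member of the chain. -/
theorem predAbove_lt_iff (s : Fin (k + 1)) (x : Fin (k + 2)) (t : Fin (k + 1)) :
    s.predAbove x < t ↔ x < s.succ.succAbove t := by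
  simp only [Fin.lt_def, val_predAbove, Fin.succAbove, Fin.val_castSucc, Fin.val_succ]
  split_ifs <;> simp only [Fin.val_castSucc, Fin.val_succ] <;> omega

theorem merge_lt_iff (p : CyclicPartition q (k + 1)) (s : Fin (k + 1)) (i : V)
    (t : Fin (k + 1)) : (p.merge s).1 i < t ↔ p.1 i < s.succ.succAbove t :=
  predAbove_lt_iff s _ t

theorem merge_lt_merge_iff (p : CyclicPartition q (k + 1)) (s : Fin (k + 1)) (i j : V) :
    (p.merge s).1 i < (p.merge s).1 j ↔
      p.1 i < p.1 j ∧ ¬ (p.1 i = s.castSucc ∧ p.1 j = s.succ) := by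
  simp only [merge, Fin.lt_def, Fin.ext_iff, val_predAbove, Fin.val_castSucc, Fin.val_succ]
  split_ifs <;> omega

theorem mergeEnds_apply_of_eq_zero (p : CyclicPartition q (k + 1)) {i : V} (h : p.1 i = 0) :
    p.mergeEnds.1 i = Fin.last k := by
  simp [mergeEnds, h]

theorem succ_mergeEnds_apply (p : CyclicPartition q (k + 1)) {i : V} (h : p.1 i ≠ 0) :
    (p.mergeEnds.1 i).succ = p.1 i := by
  obtain ⟨x, hx⟩ := Fin.exists_succ_eq.2 h
  simp [mergeEnds, ← hx]

theorem mem_block [Fintype V] (p : CyclicPartition q k) (s : Fin (k + 1)) (i : V) :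
    i ∈ p.block s ↔ p.1 i = s := by
  simp [block]

end CyclicPartition

/-! ### Edges to later blocks. -/

namespace Multigraph

variable {V : Type u} [Fintype V] [DecidableEq V]

/-- The number of edges from `i` to the blocks after the block of `i`. -/
def later (G : Multigraph V) {q : V} {k : ℕ} (p : CyclicPartition q k) (i : V) : ℤ :=
  ∑ j, (G.mult i j : ℤ) * if p.1 i < p.1 j then 1 else 0

variable (G : Multigraph V) {q : V} {k : ℕ}

theorem later_merge (p : CyclicPartition q (k + 1)) (s : Fin (k + 1)) (i : V) :
    G.later p i = G.later (p.merge s) i +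
      G.arrowExp (p.block s.castSucc) (p.block s.succ) i := by
  have h : (G.arrowExp (p.block s.castSucc) (p.block s.succ) i : ℤ) =
      ∑ j, (G.mult i j : ℤ) * if p.1 i = s.castSucc ∧ p.1 j = s.succ then 1 else 0 := by
    rw [arrowExp_apply, CyclicPartition.block, CyclicPartition.block, Finset.sum_filter]
    by_cases hi : p.1 i = s.castSucc <;> simp [hi]
  rw [h, later, later, ← Finset.sum_add_distrib]
  refine Finset.sum_congr rfl fun j _ => ?_
  rw [← mul_add]
  congr 1
  simp only [CyclicPartition.merge_lt_merge_iff]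
  by_cases h1 : p.1 i = s.castSucc ∧ p.1 j = s.succ
  · have : p.1 i < p.1 j := by rw [h1.1, h1.2]; exact s.castSucc_lt_succ
    simp [h1]
  · simp [h1]

/-- The first sum is the Laplacian of the indicator of `I_1`: moving `I_1` behind the last block
reverses its edges to the others, which firing `I_1` accounts for, except that the edges from `I_r`
to `I_1` become internal. -/
theorem later_mergeEnds (p : CyclicPartition q (k + 1)) (i : V) :
    G.later p i = (∑ j, (G.mult i j : ℤ) *
      ((if p.1 i < 1 then 1 else 0) - if p.1 j < 1 then 1 else 0)) + G.later p.mergeEnds i +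
      G.arrowExp (p.block (Fin.last (k + 1))) (p.block 0) i := by
  have h : (G.arrowExp (p.block (Fin.last (k + 1))) (p.block 0) i : ℤ) =
      ∑ j, (G.mult i j : ℤ) * if p.1 i = Fin.last (k + 1) ∧ p.1 j = 0 then 1 else 0 := by
    rw [arrowExp_apply, CyclicPartition.block, CyclicPartition.block, Finset.sum_filter]
    by_cases hi : p.1 i = Fin.last (k + 1) <;> simp [hi]
  rw [h, later, later, ← Finset.sum_add_distrib, ← Finset.sum_add_distrib]
  refine Finset.sum_congr rfl fun j _ => ?_
  rw [← mul_add, ← mul_add]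
  congr 1
  have hlast : (0 : Fin (k + 2)) ≠ Fin.last (k + 1) := (Fin.last_pos).ne
  simp only [Fin.lt_one_iff]
  by_cases hi : p.1 i = 0
  · have e1 := p.mergeEnds_apply_of_eq_zero hi
    by_cases hj : p.1 j = 0
    · simp [hi, hj, e1, hlast, Fin.le_last]
    · simp [hi, hj, e1, Fin.pos_iff_ne_zero, Fin.le_last]
  · have e1 := p.succ_mergeEnds_apply hi
    by_cases hj : p.1 j = 0
    · have e2 := p.mergeEnds_apply_of_eq_zero hj
      have e3 : p.mergeEnds.1 i < Fin.last k ↔ ¬ p.1 i = Fin.last (k + 1) := by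
        rw [← e1, ← Fin.succ_last, Fin.succ_inj, Fin.lt_last_iff_ne_last]
      by_cases h4 : p.1 i = Fin.last (k + 1) <;> simp [hi, hj, e2, e3, h4, hlast.symm]
    · have e2 := p.succ_mergeEnds_apply hj
      have : p.mergeEnds.1 i < p.mergeEnds.1 j ↔ p.1 i < p.1 j := by
        rw [← e1, ← e2, Fin.succ_lt_succ_iff]
      simp [hi, hj, this]

/-! ### Faces of `Apt(G)` -/

/-- The relation between successive vertices of a face of `Apt(G)`. -/
def aptRel (q : V) (a b : NormVec q) : Prop := a ≤ b ∧ ∀ i, b.1 i ≤ a.1 i + 1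

/-- Comparison with the coordinate `q`, where both vectors vanish, bounds each difference by one.
Comparing two coordinates then excludes differences of opposite sign. -/
theorem tropDist_le_one_iff {V : Type u} [Fintype V] {q : V} (a b : NormVec q) :
    tropDist a.1 b.1 ≤ 1 ↔ aptRel q a b ∨ aptRel q b a := by
  have h : tropDist a.1 b.1 ≤ 1 ↔ ∀ i j, (a.1 i + b.1 j - a.1 j - b.1 i).natAbs ≤ 1 := by
    rw [tropDist, Finset.sup_le_iff]
    simp
  rw [h]
  have ha := a.2
  have hb := b.2
  constructor
  · intro h
    have hq : ∀ i, a.1 i ≤ b.1 i + 1 ∧ b.1 i ≤ a.1 i + 1 := fun i => by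
      have := h i q
      omega
    by_cases hle : a ≤ b
    · exact Or.inl ⟨hle, fun i => (hq i).2⟩
    · refine Or.inr ⟨fun i => ?_, fun i => (hq i).1⟩
      have : ∃ j, b.1 j < a.1 j := by
        by_contra hc
        push Not at hc
        exact hle hc
      obtain ⟨j, hj⟩ := this
      have := h i j
      have := hq i
      change b.1 i ≤ a.1 i
      omega
  · rintro (⟨h1, h2⟩ | ⟨h1, h2⟩) i j
    · have h3 : a.1 i ≤ b.1 i := h1 i
      have h4 : a.1 j ≤ b.1 j := h1 j
      have := h2 i
      have := h2 j
      omega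
    · have h3 : b.1 i ≤ a.1 i := h1 i
      have h4 : b.1 j ≤ a.1 j := h1 j
      have := h2 i
      have := h2 j
      omega

theorem apt_isFlag (q : V) : (G.apt q).IsFlag (aptRel q) where
  refl a := ⟨le_rfl, fun i => by omega⟩
  le _ _ h := h.1
  mem_faces_iff s hs := by
    simp only [← tropDist_le_one_iff]
    exact and_iff_right hs

theorem exists_partition_of_face (σ : (G.apt q).Face k) : ∃ p : CyclicPartition q k,
    ∀ t i, (σ.1 t).1 i - (σ.1 0).1 i = if p.1 i < t then 1 else 0 := by
  have hle : ∀ s t, s ≤ t → ∀ i, (σ.1 s).1 i ≤ (σ.1 t).1 i := fun s t h =>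
    σ.1.monotone h
  have hone : ∀ t i, (σ.1 t).1 i ≤ (σ.1 0).1 i + 1 := by
    intro t i
    rcases eq_or_ne t 0 with rfl | ht
    · omega
    · have h := List.pairwise_ofFn.1 ((G.apt_isFlag q).pairwise_ofFn σ)
        (Fin.pos_iff_ne_zero.2 ht)
      exact h.2 i
  obtain ⟨p, hp⟩ := CyclicPartition.exists_of_strictMono (q := q)
    (fun t => {i | (σ.1 0).1 i < (σ.1 t).1 i}) (fun s t hst => by
      refine ⟨fun i hi => lt_of_lt_of_le hi (hle s t hst.le i), fun hsub => ?_⟩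
      refine (σ.1.strictMono hst).not_ge fun i => ?_
      have h1 := hle 0 s (Fin.zero_le _) i
      have h2 := hone t i
      by_cases hi : (σ.1 0).1 i < (σ.1 t).1 i
      · have h3 : (σ.1 0).1 i < (σ.1 s).1 i := hsub hi
        change (σ.1 t).1 i ≤ (σ.1 s).1 i
        omega
      · change (σ.1 t).1 i ≤ (σ.1 s).1 i
        omega) (by simp) (by
      change ¬ (σ.1 0).1 q < (σ.1 (Fin.last k)).1 q
      rw [(σ.1 0).2, (σ.1 _).2]
      exact lt_irrefl _)
  refine ⟨p, fun t i => ?_⟩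
  have h1 := hle 0 t (Fin.zero_le _) i
  have h2 := hone t i
  have h3 : (σ.1 0).1 i < (σ.1 t).1 i ↔ p.1 i < t := hp i t
  split_ifs with h
  · have := h3.2 h
    omega
  · have := mt h3.1 h
    omega

/-- The partition belonging to a face of `Apt(G)`. -/
noncomputable def facePartition (σ : (G.apt q).Face k) : CyclicPartition q k :=
  (G.exists_partition_of_face σ).choose

variable {G}

theorem facePartition_spec (σ : (G.apt q).Face k) (t : Fin (k + 1)) (i : V) :
    (σ.1 t).1 i - (σ.1 0).1 i = if (G.facePartition σ).1 i < t then 1 else 0 :=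
  (G.exists_partition_of_face σ).choose_spec t i

theorem facePartition_eq {σ : (G.apt q).Face k} {p : CyclicPartition q k}
    (h : ∀ t i, (σ.1 t).1 i - (σ.1 0).1 i = if p.1 i < t then 1 else 0) :
    G.facePartition σ = p := by
  refine CyclicPartition.ext_lt fun i t => ?_
  have h1 := facePartition_spec σ t i
  rw [h t i] at h1
  by_cases h2 : p.1 i < t <;> by_cases h3 : (G.facePartition σ).1 i < t <;> simp [h2, h3] at h1 ⊢

theorem face_ext {σ τ : (G.apt q).Face k} (h0 : σ.1 0 = τ.1 0)
    (hp : G.facePartition σ = G.facePartition τ) : σ = τ := by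
  ext t i
  have h1 := facePartition_spec σ t i
  have h2 := facePartition_spec τ t i
  rw [hp, h0] at h1
  omega

variable (G)

/-- The face of `Apt(G)` with first vertex `a` belonging to a partition. -/
noncomputable def partitionFace (a : NormVec q) (p : CyclicPartition q k) : (G.apt q).Face k where
  vertices := OrderEmbedding.ofStrictMono
    (fun t => ⟨fun i => a.1 i + if p.1 i < t then 1 else 0, by
      simp [a.2, p.map_base, Fin.le_last]⟩) (by
    intro s t hst
    refine lt_of_le_not_ge (fun i => ?_) fun h => ?_
    · change a.1 i + _ ≤ a.1 i + _
      have : p.1 i < s → p.1 i < t := fun h => h.trans hst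
      split_ifs <;> simp_all
    · obtain ⟨i, hi⟩ := p.surjective s
      have h1 : a.1 i + (if p.1 i < t then 1 else 0) ≤ a.1 i + (if p.1 i < s then 1 else 0) := h i
      simp [hi, hst] at h1)
  mem_faces := by
    refine ((G.apt_isFlag q).mem_faces_iff _ Finset.univ_nonempty.map).2 fun x hx y hy => ?_
    simp only [Finset.mem_map, Finset.mem_univ, true_and] at hx hy
    obtain ⟨s, rfl⟩ := hx
    obtain ⟨t, rfl⟩ := hy
    have key : ∀ s t : Fin (k + 1), s ≤ t → ∀ i,
        a.1 i + (if p.1 i < s then 1 else 0) ≤ a.1 i + (if p.1 i < t then 1 else 0) ∧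
        a.1 i + (if p.1 i < t then 1 else 0) ≤ a.1 i + (if p.1 i < s then 1 else 0) + 1 := by
      intro s t hst i
      have : p.1 i < s → p.1 i < t := fun h => h.trans_le hst
      split_ifs <;> simp_all
    rcases le_total s t with h | h
    · exact Or.inl ⟨fun i => (key s t h i).1, fun i => (key s t h i).2⟩
    · exact Or.inr ⟨fun i => (key t s h i).1, fun i => (key t s h i).2⟩

theorem partitionFace_apply (a : NormVec q) (p : CyclicPartition q k) (t : Fin (k + 1)) (i : V) :
    ((G.partitionFace a p).1 t).1 i = a.1 i + if p.1 i < t then 1 else 0 := rfl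

theorem partitionFace_zero (a : NormVec q) (p : CyclicPartition q k) :
    (G.partitionFace a p).1 0 = a := by
  ext i
  simp [partitionFace_apply]

theorem facePartition_partitionFace (a : NormVec q) (p : CyclicPartition q k) :
    G.facePartition (G.partitionFace a p) = p :=
  facePartition_eq fun t i => by simp [partitionFace_apply]

/-- Relative to the first vertex, the label at `a_t` is a weighted sum over `j` of differences of
indicators, each at most the indicator that `j` lies in a later block than `i`. All these bounds are
attained at one vertex, depending on `i`. -/
theorem label_eq_laplacian_add_later (σ : (G.apt q).Face k) (i : V) :
    σ.label i = G.laplacian.mulVec (σ.1 0).1 i + G.later (G.facePartition σ) i := by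
  set p := G.facePartition σ with hp
  have hv : ∀ t, (G.apt q).label (σ.1 t) i = G.laplacian.mulVec (σ.1 0).1 i +
      ∑ j, (G.mult i j : ℤ) * ((if p.1 i < t then 1 else 0) - if p.1 j < t then 1 else 0) := by
    intro t
    change G.laplacian.mulVec (σ.1 t).1 i = _
    rw [laplacian_mulVec_apply, laplacian_mulVec_apply, ← Finset.sum_add_distrib]
    refine Finset.sum_congr rfl fun j _ => ?_
    rw [← mul_add]
    congr 1
    have h1 := facePartition_spec σ t i
    have h2 := facePartition_spec σ t j
    rw [← hp] at h1 h2
    omega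
  apply le_antisymm
  · rw [LabeledComplex.Face.label, Finset.sup'_apply]
    refine Finset.sup'_le _ _ fun t _ => ?_
    rw [hv, later]
    gcongr with j
    by_cases h1 : p.1 i < t <;> by_cases h2 : p.1 j < t <;> by_cases h3 : p.1 i < p.1 j <;>
      simp [h1, h2, h3]
    exact h3 (h1.trans_le (not_lt.1 h2))
  · have hle : ∀ t, (G.apt q).label (σ.1 t) i ≤ σ.label i := fun t => σ.label_le_iff.1 le_rfl t i
    rcases Fin.eq_castSucc_or_eq_last (p.1 i) with ⟨s, hs⟩ | hlast
    -- The maximum is attained at the first vertex whose indicator contains `i`.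
    · refine le_trans (le_of_eq ?_) (hle s.succ)
      rw [hv, later]
      congr 1
      refine Finset.sum_congr rfl fun j _ => ?_
      have h1 : p.1 j < s.succ ↔ ¬ s.castSucc < p.1 j := by
        rw [not_lt, Fin.le_castSucc_iff]
      by_cases h2 : s.castSucc < p.1 j <;> simp [hs, h1, h2]
    -- If `i` is in the last block there is nothing later, and the initial vertex attains the
    -- maximum.
    · refine le_trans (le_of_eq ?_) (hle 0)
      rw [hv, later, hlast]
      simp [(Fin.le_last _).not_gt]

end Multigraph

namespace Multigraph

variable {V : Type u} [Fintype V] [DecidableEq V] (G : Multigraph V) {q : V} {k : ℕ}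

/-- With `a_1` as the new base point, `I_1` is added last in the cyclic order, hence joins the block
of `q`. -/
theorem facePartition_delete_zero (σ : (G.apt q).Face (k + 1)) :
    G.facePartition (σ.delete 0) = (G.facePartition σ).mergeEnds := by
  refine facePartition_eq fun t i => ?_
  set p := G.facePartition σ with hp
  have h1 := facePartition_spec σ t.succ i
  have h2 := facePartition_spec σ 1 i
  rw [← hp] at h1 h2
  have h3 : (σ.delete 0).1 t = σ.1 t.succ := rfl
  have h4 : (σ.delete 0).1 0 = σ.1 1 := rfl
  rw [h3, h4]
  by_cases hi : p.1 i = 0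
  · rw [p.mergeEnds_apply_of_eq_zero hi, if_neg (Fin.le_last t).not_gt]
    simp [hi] at h1 h2
    omega
  · have e := p.succ_mergeEnds_apply hi
    have h5 : p.1 i < t.succ ↔ p.mergeEnds.1 i < t := by rw [← e, Fin.succ_lt_succ_iff]
    have h6 : ¬ p.1 i < 1 := by rwa [Fin.lt_one_iff]
    simp only [h5] at h1
    rw [if_neg h6] at h2
    omega

theorem facePartition_delete_succ (σ : (G.apt q).Face (k + 1)) (s : Fin (k + 1)) :
    G.facePartition (σ.delete s.succ) = (G.facePartition σ).merge s := by
  refine facePartition_eq fun t i => ?_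
  have h1 := facePartition_spec σ (s.succ.succAbove t) i
  have h3 : (σ.delete s.succ).1 t = σ.1 (s.succ.succAbove t) := rfl
  have h4 : (σ.delete s.succ).1 0 = σ.1 0 := congrArg σ.1 (Fin.succ_succAbove_zero s)
  rw [h3, h4, h1]
  simp only [CyclicPartition.merge_lt_iff]

theorem label_sub_label_delete_zero (σ : (G.apt q).Face (k + 1)) (i : V) :
    σ.label i - (σ.delete 0).label i =
      G.arrowExp ((G.facePartition σ).block (Fin.last (k + 1))) ((G.facePartition σ).block 0) i := by
  rw [label_eq_laplacian_add_later, label_eq_laplacian_add_later, facePartition_delete_zero]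
  set p := G.facePartition σ with hp
  have h4 : (σ.delete 0).1 0 = σ.1 1 := rfl
  have h5 : G.laplacian.mulVec (σ.1 1).1 i = G.laplacian.mulVec (σ.1 0).1 i +
      ∑ j, (G.mult i j : ℤ) * ((if p.1 i < 1 then 1 else 0) - if p.1 j < 1 then 1 else 0) := by
    rw [laplacian_mulVec_apply, laplacian_mulVec_apply, ← Finset.sum_add_distrib]
    refine Finset.sum_congr rfl fun j _ => ?_
    rw [← mul_add]
    congr 1
    have h1 := facePartition_spec σ 1 i
    have h2 := facePartition_spec σ 1 j
    rw [← hp] at h1 h2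
    omega
  rw [h4, h5, G.later_mergeEnds p i]
  ring

theorem label_sub_label_delete_succ (σ : (G.apt q).Face (k + 1)) (s : Fin (k + 1)) (i : V) :
    σ.label i - (σ.delete s.succ).label i =
      G.arrowExp ((G.facePartition σ).block s.castSucc) ((G.facePartition σ).block s.succ) i := by
  rw [label_eq_laplacian_add_later, label_eq_laplacian_add_later, facePartition_delete_succ,
    G.later_merge (G.facePartition σ) s i]
  have h4 : (σ.delete s.succ).1 0 = σ.1 0 := congrArg σ.1 (Fin.succ_succAbove_zero s)
  rw [h4]
  ring

theorem monomial_eq_arrow {K : Type w} [Field K] {a : V → ℤ} {I J : Finset V}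
    (h : ∀ i, a i = G.arrowExp I J i) :
    monomial (Finsupp.equivFunOnFinite.symm fun i => (a i).toNat) 1 = G.arrow K I J := by
  have e : (Finsupp.equivFunOnFinite.symm fun i => (a i).toNat) = G.arrowExp I J :=
    Finsupp.ext fun i => by rw [Finsupp.equivFunOnFinite_symm_apply_apply, h, Int.toNat_natCast]
  rw [e, arrow]

theorem mapDomain_facePartition_cellularD {K : Type w} [Field K]
    (f : (G.apt q).Face (k + 1) →₀ MvPolynomial V K) :
    Finsupp.mapDomain G.facePartition ((G.apt q).cellularD K k f) =
      -(G.cycD K q k (Finsupp.mapDomain G.facePartition f)) := by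
  suffices h : Finsupp.lmapDomain _ (MvPolynomial V K) G.facePartition ∘ₗ (G.apt q).cellularD K k =
      -(G.cycD K q k ∘ₗ Finsupp.lmapDomain _ (MvPolynomial V K) G.facePartition) from
    LinearMap.congr_fun h f
  refine Finsupp.lhom_ext' fun σ => LinearMap.ext_ring ?_
  simp only [LinearMap.comp_apply, LinearMap.neg_apply, Finsupp.lsingle_apply,
    Finsupp.lmapDomain_apply, Finsupp.mapDomain_single, LabeledComplex.cellularD, cycD,
    Finsupp.linearCombination_single, one_smul]
  -- Deleting `a_0` gives the wrap-around term with sign `+`, and deleting the vertex with index `s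
  -- + 1` merges blocks `s` and `s + 1` with sign `(-1)^(s+1)`. Both are opposite to `cycD`.
  rw [Fin.sum_univ_succ, Finsupp.mapDomain_add, Finsupp.mapDomain_finsetSum, neg_sub,
    sub_eq_add_neg, ← Finset.sum_neg_distrib, Finsupp.mapDomain_single]
  congr 1
  · rw [facePartition_delete_zero, monomial_eq_arrow G fun i => G.label_sub_label_delete_zero σ i]
    simp
  · refine Finset.sum_congr rfl fun s _ => ?_
    rw [Finsupp.mapDomain_single, facePartition_delete_succ,
      monomial_eq_arrow G fun i => G.label_sub_label_delete_succ σ s i, ← Finsupp.single_neg]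
    congr 1
    rw [Fin.val_succ, pow_succ]
    ring

theorem cycSupportedOnApt (K : Type w) [Field K] (q : V) : G.CycSupportedOnApt K q := by
  refine ⟨fun k => G.facePartition, fun k p => ⟨_, G.facePartition_partitionFace ⟨0, rfl⟩ p⟩,
    fun k σ τ => ⟨fun h => ?_, ?_⟩, fun k σ t i => facePartition_spec σ t i,
    fun k f => G.mapDomain_facePartition_cellularD f⟩
  · refine ⟨⟨(τ.1 0).1 - (σ.1 0).1, by simp [(τ.1 0).2, (σ.1 0).2]⟩, fun t => ?_⟩
    ext i
    have h1 := facePartition_spec σ t i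
    have h2 := facePartition_spec τ t i
    rw [show G.facePartition σ = G.facePartition τ from h] at h1
    simp only [Pi.add_apply, Pi.sub_apply]
    omega
  · rintro ⟨c, hc⟩
    refine (facePartition_eq fun t i => ?_).symm
    rw [← facePartition_spec σ t i, hc, hc]
    simp

/-! ### Contractibility of the sublevel complexes -/

variable {G}

/-- The coordinates of `Λa` sum to zero, so upper bounds on all of them imply lower bounds;
connectedness makes `Λ` injective on normalised vectors. -/
theorem Connected.finite_laplacian_mulVec_le (hG : G.Connected) (q : V) (b : V → ℤ) :
    {a : NormVec q | G.laplacian.mulVec a.1 ≤ b}.Finite := by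
  refine Set.Finite.of_injOn (f := fun a : NormVec q => G.laplacian.mulVec a.1)
    (t := Set.Icc (fun i => b i - ∑ j, b j) b) (fun a ha => ⟨fun i => ?_, ha⟩)
    (hG.laplacian_mulVec_injective q).injOn (Set.finite_Icc _ _)
  have hsum : ∑ i, G.laplacian.mulVec a.1 i = 0 := by
    have h1 : ∑ i, G.laplacian.mulVec a.1 i = -∑ i, G.laplacian.mulVec a.1 i := by
      simp only [laplacian_mulVec_apply]
      conv_rhs => rw [Finset.sum_comm]
      rw [← Finset.sum_neg_distrib]
      refine Finset.sum_congr rfl fun i _ => ?_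
      rw [← Finset.sum_neg_distrib]
      refine Finset.sum_congr rfl fun j _ => ?_
      rw [G.symm]
      ring
    omega
  have h2 : ∑ j ∈ Finset.univ.erase i, G.laplacian.mulVec a.1 j ≤
      ∑ j ∈ Finset.univ.erase i, b j := Finset.sum_le_sum fun j _ => ha j
  have h3 := Finset.add_sum_erase Finset.univ (G.laplacian.mulVec a.1) (Finset.mem_univ i)
  have h4 := Finset.add_sum_erase Finset.univ b (Finset.mem_univ i)
  change b i - ∑ j, b j ≤ G.laplacian.mulVec a.1 i
  omega

/-- At a coordinate where `a` attains the maximum, passing to `a ⊔ a'` keeps `a i` and can only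
raise its neighbours, which lowers the Laplacian there. -/
theorem laplacian_mulVec_sup_le {a a' b : V → ℤ} (h : G.laplacian.mulVec a ≤ b)
    (h' : G.laplacian.mulVec a' ≤ b) : G.laplacian.mulVec (a ⊔ a') ≤ b := by
  have key : ∀ a a' : V → ℤ, ∀ i, a' i ≤ a i →
      G.laplacian.mulVec (a ⊔ a') i ≤ G.laplacian.mulVec a i := by
    intro a a' i hi
    rw [laplacian_mulVec_apply, laplacian_mulVec_apply]
    gcongr with j
    · exact (sup_eq_left.2 hi).le
    · exact le_sup_left
  intro i
  rcases le_total (a' i) (a i) with hi | hi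
  · exact (key a a' i hi).trans (h i)
  · rw [sup_comm]
    exact (key a' a i hi).trans (h' i)

theorem Connected.apt_isContractible (hG : G.Connected) (q : V) (b : V → ℤ)
    (hb : ∃ a, (G.apt q).label a ≤ b) :
    ListChain.IsContractible (aptRel q) fun a => (G.apt q).label a ≤ b := by
  set S : Finset (NormVec q) := (hG.finite_laplacian_mulVec_le q b).toFinset with hS
  have hmem : ∀ a : NormVec q, a ∈ S ↔ G.laplacian.mulVec a.1 ≤ b := by simp [hS]
  have hne : S.Nonempty := by
    obtain ⟨a, ha⟩ := hb
    exact ⟨a, (hmem a).2 ha⟩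
  set M : V → ℤ := S.sup' hne fun a => a.1 with hM
  have hMP : M ∈ {x : V → ℤ | x q = 0 ∧ G.laplacian.mulVec x ≤ b} :=
    Finset.sup'_mem {x : V → ℤ | x q = 0 ∧ G.laplacian.mulVec x ≤ b}
      (fun x hx y hy => ⟨by simp [hx.1, hy.1], laplacian_mulVec_sup_le hx.2 hy.2⟩) S hne _
      fun a ha => ⟨a.2, (hmem a).1 ha⟩
  have hle : ∀ a ∈ S, a.1 ≤ M := fun a ha => Finset.le_sup' (fun a : NormVec q => a.1) ha
  set N : ℕ := ∑ a ∈ S, ∑ i, (M i - a.1 i).natAbs with hN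
  have hNle : ∀ a ∈ S, ∀ i, M i - N ≤ a.1 i := by
    intro a ha i
    have h1 := Finset.single_le_sum (f := fun i => (M i - a.1 i).natAbs)
      (fun _ _ => Nat.zero_le _) (Finset.mem_univ i)
    have h2 := Finset.single_le_sum (f := fun a : NormVec q => ∑ i, (M i - a.1 i).natAbs)
      (fun _ _ => Nat.zero_le _) ha
    have h3 : (M i - a.1 i).natAbs ≤ N := h1.trans h2
    omega
  -- The deformation is `a ↦ max(a, M - c)`: it is constant for `c = 0`, the identity for `c = N`,
  -- and raises coordinates by at most one when `c` decreases by one. Adding a constant to `M` does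
  -- not change its Laplacian, and the coordinate at `q` stays zero because `c ≥ 0`.
  refine ⟨⟨M, hMP.1⟩, N, fun c a => ⟨a.1 ⊔ fun i => M i + -(c : ℤ), by simp [a.2, hMP.1]⟩,
    fun a ha => ?_, fun a ha => ?_, fun c a ha => ?_, fun c x y _ _ hxy => ?_⟩
  · refine Subtype.ext (sup_eq_left.2 fun i => ?_)
    have := hNle a ((hmem a).2 ha) i
    change M i + -(N : ℤ) ≤ a.1 i
    omega
  · refine Subtype.ext ?_
    simpa using hle a ((hmem a).2 ha)
  · refine laplacian_mulVec_sup_le ha ?_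
    rw [G.laplacian_mulVec_add_const]
    exact hMP.2
  · have h1 : ∀ i, x.1 i ≤ y.1 i := hxy.1
    have h2 := hxy.2
    refine ⟨⟨fun i => ?_, fun i => ?_⟩, ⟨fun i => ?_, fun i => ?_⟩⟩
    · change max (x.1 i) _ ≤ max (y.1 i) _
      have := h1 i
      omega
    · change max (y.1 i) _ ≤ max (x.1 i) _ + 1
      have := h2 i
      omega
    · change max (x.1 i) (M i + -((c + 1 : ℕ) : ℤ)) ≤ max (y.1 i) (M i + -(c : ℤ))
      have := h1 i
      omega
    · change max (y.1 i) (M i + -(c : ℤ)) ≤ max (x.1 i) (M i + -((c + 1 : ℕ) : ℤ)) + 1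
      have := h2 i
      omega

theorem Connected.apt_isCellularResolution (hG : G.Connected) (K : Type w) [Field K] (q : V) :
    (G.apt q).IsCellularResolution (G.latticeModule K) := by
  refine ⟨?_, (G.apt_isFlag q).isFreeResolution (hG.apt_isContractible q)⟩
  rw [LabeledComplex.range_cellularAug, latticeModule]
  congr 1
  ext f
  constructor
  · rintro ⟨a, rfl⟩
    exact ⟨_, (G.mem_laplacianLattice_iff_normVec q).2 ⟨a, rfl⟩, rfl⟩
  · rintro ⟨a, ha, rfl⟩
    obtain ⟨c, rfl⟩ := (G.mem_laplacianLattice_iff_normVec q).1 ha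
    exact ⟨c, rfl⟩

/-! ### The resolution `CYC` -/

/-- The chosen vector in the class of `b` modulo the Laplacian lattice. -/
noncomputable def classRep (G : Multigraph V) (b : V → ℤ) : V → ℤ :=
  (QuotientAddGroup.mk b : (V → ℤ) ⧸ G.laplacianLattice).out

theorem classRep_sub_mem (b : V → ℤ) : G.classRep b - b ∈ G.laplacianLattice := by
  have h : (QuotientAddGroup.mk b : (V → ℤ) ⧸ G.laplacianLattice) =
      QuotientAddGroup.mk (G.classRep b) := (Quotient.out_eq' _).symm
  rw [QuotientAddGroup.eq] at h
  rwa [sub_eq_neg_add]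

theorem classRep_eq {b b' : V → ℤ} (h : b' - b ∈ G.laplacianLattice) :
    G.classRep b = G.classRep b' := by
  have : (QuotientAddGroup.mk b : (V → ℤ) ⧸ G.laplacianLattice) = QuotientAddGroup.mk b' := by
    rw [QuotientAddGroup.eq]
    rwa [← sub_eq_neg_add]
  rw [classRep, this, classRep]

theorem classRep_classRep (b : V → ℤ) : G.classRep (G.classRep b) = G.classRep b :=
  (classRep_eq (classRep_sub_mem b)).symm

theorem label_partitionFace (a : NormVec q) (p : CyclicPartition q k) :
    (G.partitionFace a p).label = G.laplacian.mulVec a.1 + G.later p := by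
  ext i
  rw [label_eq_laplacian_add_later, partitionFace_zero, facePartition_partitionFace, Pi.add_apply]

/-- The translation needed to lift a basis element of `CYC` to the chosen degree. -/
theorem exists_normVec_classRep (p : CyclicPartition q k) (u : V →₀ ℕ) : ∃ a : NormVec q,
    G.laplacian.mulVec a.1 + G.later p + (fun i => (u i : ℤ)) =
      G.classRep (G.later p + fun i => (u i : ℤ)) := by
  obtain ⟨c, hc⟩ := (G.mem_laplacianLattice_iff_normVec q).1
    (classRep_sub_mem (G := G) (G.later p + fun i => (u i : ℤ)))
  exact ⟨c, by rw [hc]; abel⟩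

/-- A degree in `CYC_G` is defined only modulo the lattice. Lifting each basis vector to the face
whose degree is the chosen representative gives a section of the quotient map that respects
boundaries up to sign, so a cycle lifts to a cycle, bounds upstairs, and its bounding chain is
pushed down. -/
theorem Connected.exact_cycD (hG : G.Connected) (K : Type w) [Field K] (q : V) (k : ℕ) :
    Function.Exact (G.cycD K q (k + 1)) (G.cycD K q k) := by
  classical
  have hsurj : ∀ n, Function.Surjective (Finsupp.mapDomain (M := MvPolynomial V K)
      (G.facePartition (q := q) (k := n))) := fun n =>
    Finsupp.mapDomain_surjective fun p => ⟨_, G.facePartition_partitionFace ⟨0, rfl⟩ p⟩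
  choose a ha using fun n (p : CyclicPartition q n) u => exists_normVec_classRep (G := G) p u
  let s : ∀ n, (CyclicPartition q n →₀ MvPolynomial V K) →ₗ[K]
      ((G.apt q).Face n →₀ MvPolynomial V K) := fun n =>
    (monomialBasis V K _).constr K fun x =>
      Finsupp.single (G.partitionFace (a n x.1 x.2) x.1) (monomial x.2 1)
  have hs : ∀ n p u, s n (Finsupp.single p (monomial u 1)) =
      Finsupp.single (G.partitionFace (a n p u) p) (monomial u 1) := by
    intro n p u
    rw [← monomialBasis_apply]
    exact (monomialBasis V K _).constr_basis K _ _
  have hπs : ∀ n f, Finsupp.mapDomain G.facePartition (s n f) = f := by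
    intro n f
    suffices h : (Finsupp.lmapDomain _ (MvPolynomial V K) G.facePartition).restrictScalars K ∘ₗ
        s n = LinearMap.id from LinearMap.congr_fun h f
    refine monomial_basis_hom_ext fun p u => ?_
    rw [LinearMap.comp_apply, hs, LinearMap.restrictScalars_apply, Finsupp.lmapDomain_apply,
      Finsupp.mapDomain_single, facePartition_partitionFace, LinearMap.id_apply]
  -- A vector already in a representative degree is its own lift: its partition and degree determine
  -- the Laplacian of its first vertex, and connectedness recovers that vertex.
  have hsπ : ∀ n (σ : (G.apt q).Face n) b, σ.label ≤ b → G.classRep b = b →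
      s n (Finsupp.mapDomain G.facePartition (σ.vec K b)) = σ.vec K b := by
    intro n σ b hb hrep
    rw [LabeledComplex.Face.vec, Finsupp.mapDomain_single, hs]
    congr 1
    refine face_ext ?_ (G.facePartition_partitionFace _ _)
    rw [partitionFace_zero]
    set u := toExp (b - σ.label) with hu
    set p := G.facePartition σ with hp
    have hlab : σ.label = G.laplacian.mulVec (σ.1 0).1 + G.later p :=
      funext fun i => G.label_eq_laplacian_add_later σ i
    have hbu : G.laplacian.mulVec (σ.1 0).1 + (G.later p + fun i => (u i : ℤ)) = b := by
      rw [← add_assoc, ← hlab]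
      ext i
      have : σ.label i ≤ b i := hb i
      simp only [hu, toExp_apply, Pi.add_apply, Pi.sub_apply]
      omega
    refine hG.laplacian_mulVec_injective q ?_
    have h1 := ha n p u
    rw [classRep_eq (b' := b) ((G.mem_laplacianLattice_iff_normVec q).2 ⟨σ.1 0, by
      rw [← hbu, add_sub_cancel_right]⟩), hrep, ← hbu, add_assoc] at h1
    exact add_right_cancel h1
  -- The boundary preserves the degree, so the boundary of a lift lies again in a representative
  -- degree and equals the lift of its image.
  have hds : ∀ n f, (G.apt q).cellularD K n (s (n + 1) f) = -s n (G.cycD K q n f) := by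
    intro n f
    have hsd : s n (Finsupp.mapDomain G.facePartition
        ((G.apt q).cellularD K n (s (n + 1) f))) = (G.apt q).cellularD K n (s (n + 1) f) := by
      suffices h : s n ∘ₗ (Finsupp.lmapDomain _ (MvPolynomial V K)
          G.facePartition).restrictScalars K ∘ₗ ((G.apt q).cellularD K n).restrictScalars K ∘ₗ
          s (n + 1) = ((G.apt q).cellularD K n).restrictScalars K ∘ₗ s (n + 1) from
        LinearMap.congr_fun h f
      refine monomial_basis_hom_ext fun p u => ?_
      simp only [LinearMap.comp_apply, hs]
      set σ := G.partitionFace (a (n + 1) p u) p with hσ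
      have hrep : G.classRep (σ.label + fun i => (u i : ℤ)) = σ.label + fun i => (u i : ℤ) := by
        rw [hσ, label_partitionFace, ha, classRep_classRep]
      rw [← σ.vec_label_add]
      set b := σ.label + fun i => (u i : ℤ)
      have hb : σ.label ≤ b := le_add_of_nonneg_right fun i => by simp
      simp only [LinearMap.restrictScalars_apply, (G.apt q).cellularD_vec σ hb, map_sum]
      refine Finset.sum_congr rfl fun j _ => ?_
      have e : (Finsupp.lmapDomain _ (MvPolynomial V K) G.facePartition)
          ((-1 : K) ^ (j : ℕ) • (σ.delete j).vec K b) = (-1 : K) ^ (j : ℕ) •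
          Finsupp.mapDomain G.facePartition ((σ.delete j).vec K b) :=
        ((Finsupp.lmapDomain _ (MvPolynomial V K) G.facePartition).restrictScalars K).map_smul _ _
      rw [e, map_smul, hsπ n _ b ((σ.label_delete_le j).trans hb) hrep]
    rw [← hsd, G.mapDomain_facePartition_cellularD, hπs, map_neg]
  intro f
  constructor
  · intro hf
    have h1 : (G.apt q).cellularD K k (s (k + 1) f) = 0 := by rw [hds, hf, map_zero, neg_zero]
    obtain ⟨g, hg⟩ := ((hG.apt_isCellularResolution K q).2.2.2 k _).1 h1
    refine ⟨-Finsupp.mapDomain G.facePartition g, ?_⟩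
    rw [map_neg, ← G.mapDomain_facePartition_cellularD, hg, hπs]
  · rintro ⟨g, rfl⟩
    obtain ⟨g, rfl⟩ := hsurj _ g
    have h1 := G.mapDomain_facePartition_cellularD ((G.apt q).cellularD K (k + 1) g)
    rw [(G.apt_isFlag q).cellularD_cellularD, G.mapDomain_facePartition_cellularD, map_neg,
      neg_neg, Finsupp.mapDomain_zero] at h1
    exact h1.symm

end Multigraph

namespace Multigraph

variable {V : Type u} [Fintype V] [DecidableEq V] (G : Multigraph V) {q : V} {k : ℕ}

/-! ### Faces of `Bary(G)` -/

theorem bary_isFlag (q : V) : (G.bary q).IsFlag (· ≤ ·) where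
  refl _ := le_rfl
  le _ _ h := h
  mem_faces_iff s hs := by
    constructor
    · intro h x hx y hy
      exact h.2.total hx hy
    · intro h
      exact ⟨hs, fun x hx y hy _ => h x hx y hy⟩

/-- The flag of initial unions of blocks of a partition. -/
def baryFace (p : CyclicPartition q (k + 1)) : (G.bary q).Face k where
  vertices := OrderEmbedding.ofStrictMono
    (fun t => ⟨Finset.univ.filter fun i => p.1 i ≤ t.castSucc, by
      obtain ⟨i, hi⟩ := p.surjective 0
      exact ⟨i, by simp [hi]⟩, by simp [p.map_base, Fin.last_le_iff, Fin.castSucc_ne_last]⟩) (by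
    intro s t hst
    refine lt_of_le_not_ge (fun i hi => ?_) fun h => ?_
    · simp only [Finset.mem_filter] at hi ⊢
      exact ⟨hi.1, hi.2.trans (Fin.castSucc_le_castSucc_iff.2 hst.le)⟩
    · obtain ⟨i, hi⟩ := p.surjective t.castSucc
      have h1 : i ∈ Finset.univ.filter fun i => p.1 i ≤ s.castSucc := h (by simp [hi])
      rw [Finset.mem_filter, hi, Fin.castSucc_le_castSucc_iff] at h1
      exact h1.2.not_gt hst)
  mem_faces := by
    refine ⟨Finset.univ_nonempty.map, fun x hx y hy _ => ?_⟩
    simp only [Finset.coe_map, Finset.coe_univ, Set.image_univ, Set.mem_range] at hx hy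
    obtain ⟨s, rfl⟩ := hx
    obtain ⟨t, rfl⟩ := hy
    exact (le_total s t).imp (fun h => OrderEmbedding.monotone _ h)
      fun h => OrderEmbedding.monotone _ h

theorem mem_baryFace (p : CyclicPartition q (k + 1)) (t : Fin (k + 1)) (i : V) :
    i ∈ ((G.baryFace p).1 t).1 ↔ p.1 i ≤ t.castSucc :=
  Finset.mem_filter_univ i

theorem bary_face_ext {σ τ : (G.bary q).Face k}
    (h : ∀ t i, i ∈ (σ.1 t).1 ↔ i ∈ (τ.1 t).1) : σ = τ := by
  ext t i
  exact h t i

theorem baryFace_bijective : Function.Bijective (G.baryFace (q := q) (k := k)) := by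
  constructor
  · intro p p' h
    refine CyclicPartition.ext_lt fun i t => ?_
    rcases Fin.eq_zero_or_eq_succ t with rfl | ⟨t, rfl⟩
    · simp
    · rw [← Fin.le_castSucc_iff, ← Fin.le_castSucc_iff, ← G.mem_baryFace, ← G.mem_baryFace, h]
  · intro σ
    -- The empty set, the initial union of no blocks, is prepended to the flag.
    obtain ⟨p, hp⟩ := CyclicPartition.exists_of_strictMono (q := q)
      (Fin.cons ∅ fun t => ((σ.1 t).1 : Set V) : Fin (k + 2) → Set V) (by
        rw [Fin.strictMono_iff_lt_succ]
        intro t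
        rcases Fin.eq_zero_or_eq_succ t.castSucc with h | ⟨s, hs⟩
        · rw [h, Fin.cons_zero, Fin.cons_succ, Set.empty_ssubset]
          exact (σ.1 t).2.1
        · rw [hs, Fin.cons_succ, Fin.cons_succ]
          refine Finset.coe_ssubset.2 (σ.1.strictMono ?_)
          rw [← Fin.succ_lt_succ_iff, ← hs]
          exact t.castSucc_lt_succ) (by rfl) (by
        rw [← Fin.succ_last, Fin.cons_succ]
        exact (σ.1 _).2.2)
    refine ⟨p, G.bary_face_ext fun t i => ?_⟩
    rw [G.mem_baryFace, Fin.le_castSucc_iff, ← hp i t.succ, Fin.cons_succ, Finset.mem_coe]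

theorem baryFace_merge (p : CyclicPartition q (k + 2)) (s : Fin (k + 2)) :
    G.baryFace (p.merge s) = (G.baryFace p).delete s := by
  refine G.bary_face_ext fun t i => ?_
  have h : ((G.baryFace p).delete s).1 t = (G.baryFace p).1 (s.succAbove t) := rfl
  rw [h, G.mem_baryFace, G.mem_baryFace, Fin.le_castSucc_iff, Fin.le_castSucc_iff,
    p.merge_lt_iff, Fin.succ_succAbove_succ]

/-- A member of the flag containing `i` contributes the edges from `i` out of it, most for the
smallest such member; a member without `i` contributes zero. -/
theorem label_baryFace (p : CyclicPartition q (k + 1)) (i : V) :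
    (G.baryFace p).label i = G.later p i := by
  have hv : ∀ t, (G.bary q).label ((G.baryFace p).1 t) i = if p.1 i ≤ t.castSucc then
      ∑ j, (G.mult i j : ℤ) * (if t.castSucc < p.1 j then 1 else 0) else 0 := by
    intro t
    change (G.arrowExp _ _ i : ℤ) = _
    have hc : ((G.baryFace p).1 t).1ᶜ = Finset.univ.filter fun j => t.castSucc < p.1 j := by
      ext j
      simp [mem_baryFace]
    rw [arrowExp_apply, hc, Finset.sum_filter]
    simp [mem_baryFace]
  apply le_antisymm
  · rw [LabeledComplex.Face.label, Finset.sup'_apply]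
    refine Finset.sup'_le _ _ fun t _ => ?_
    rw [hv, later]
    split_ifs with h
    · gcongr with j
      by_cases h1 : t.castSucc < p.1 j
      · simp [h1, h.trans_lt h1]
      · rw [if_neg h1]
        split_ifs <;> simp
    · exact Finset.sum_nonneg fun j _ => by positivity
  · have hle : ∀ t, (G.bary q).label ((G.baryFace p).1 t) i ≤ (G.baryFace p).label i := fun t =>
      (G.baryFace p).label_le_iff.1 le_rfl t i
    rcases Fin.eq_castSucc_or_eq_last (p.1 i) with ⟨s, hs⟩ | hlast
    · refine le_trans (le_of_eq ?_) (hle s)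
      rw [hv, later, hs, if_pos le_rfl]
    · refine le_trans (le_of_eq ?_) (hle 0)
      rw [hv, later, hlast, if_neg (by simp)]
      simp [(Fin.le_last _).not_gt]

/-- Enlarging a set containing `i` can only lose edges leaving it at `i`; this is the analogue for
sets of closure under maximum. -/
theorem arrowExp_union_le (I J : Finset V) (b : V → ℤ)
    (hI : ∀ i, (G.arrowExp I Iᶜ i : ℤ) ≤ b i) (hJ : ∀ i, (G.arrowExp J Jᶜ i : ℤ) ≤ b i) (i : V) :
    (G.arrowExp (I ∪ J) (I ∪ J)ᶜ i : ℤ) ≤ b i := by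
  have key : ∀ I J : Finset V, i ∈ I →
      G.arrowExp (I ∪ J) (I ∪ J)ᶜ i ≤ G.arrowExp I Iᶜ i := by
    intro I J hi
    rw [arrowExp_apply, arrowExp_apply, if_pos hi, if_pos (Finset.mem_union_left _ hi)]
    exact Finset.sum_le_sum_of_subset (by simp)
  by_cases h1 : i ∈ I
  · exact le_trans (by exact_mod_cast key I J h1) (hI i)
  · by_cases h2 : i ∈ J
    · rw [Finset.union_comm]
      exact le_trans (by exact_mod_cast key J I h2) (hJ i)
    · have := hI i
      simp only [arrowExp_apply, h1, if_false] at this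
      simpa [h1, h2] using this

theorem bary_isContractible (q : V) (b : V → ℤ) (hb : ∃ I, (G.bary q).label I ≤ b) :
    ListChain.IsContractible (· ≤ ·) fun I => (G.bary q).label I ≤ b := by
  classical
  set S := Finset.univ.filter fun I : {I : Finset V // I.Nonempty ∧ q ∉ I} =>
    (G.bary q).label I ≤ b with hS
  have hmem : ∀ I, I ∈ S ↔ (G.bary q).label I ≤ b := by simp [hS]
  have hne : S.Nonempty := by
    obtain ⟨I, hI⟩ := hb
    exact ⟨I, (hmem I).2 hI⟩
  set T : Set (Finset V) := {I | (I.Nonempty ∧ q ∉ I) ∧ ∀ i, (G.arrowExp I Iᶜ i : ℤ) ≤ b i}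
  have hM : S.sup' hne (fun I => I.1) ∈ T := by
    refine Finset.sup'_mem T (fun I hI J hJ => ⟨⟨?_, ?_⟩, ?_⟩) S hne _
      fun I hI => ⟨I.2, (hmem I).1 hI⟩
    · exact hI.1.1.mono Finset.subset_union_left
    · exact fun h => (Finset.mem_union.1 h).elim hI.1.2 hJ.1.2
    · exact G.arrowExp_union_le I J b hI.2 hJ.2
  set M : {I : Finset V // I.Nonempty ∧ q ∉ I} := ⟨_, hM.1⟩ with hMdef
  have hle : ∀ I, (G.bary q).label I ≤ b → I ≤ M := fun I hI =>
    Finset.le_sup' (fun I : {I : Finset V // I.Nonempty ∧ q ∉ I} => I.1) ((hmem I).2 hI)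
  -- One elementary homotopy suffices: `I ≤ M` for every `I` of the sublevel complex, so the
  -- identity and the constant map `M` are comparable.
  refine ⟨M, 1, fun c I => if c = 0 then M else I, by simp, by simp, fun c I hI => ?_,
    fun c I J hI hJ hIJ => ?_⟩
  · by_cases hc : c = 0
    · simp only [hc, if_true]
      exact hM.2
    · simpa [hc] using hI
  · by_cases hc : c = 0
    · simpa [hc] using hle I hI
    · simpa [hc] using hIJ

theorem bary_isCellularResolution (K : Type w) [Field K] (q : V) :
    (G.bary q).IsCellularResolution (Submodule.map
      (Algebra.linearMap (MvPolynomial V K) (Laurent V K)) (G.parkingIdeal K q)) := by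
  refine ⟨?_, (G.bary_isFlag q).isFreeResolution (G.bary_isContractible q)⟩
  rw [LabeledComplex.range_cellularAug, parkingIdeal, Ideal.span, Submodule.map_span]
  congr 1
  ext f
  constructor
  · rintro ⟨I, rfl⟩
    exact ⟨_, ⟨I.1, I.2.1, I.2.2, rfl⟩, Laurent.algebraMap_monomial _⟩
  · rintro ⟨_, ⟨I, hI, hq, rfl⟩, rfl⟩
    exact ⟨⟨I, hI, hq⟩, (Laurent.algebraMap_monomial _).symm⟩

/-! ### Comparison of the complex for `M_G` with `Bary(G)`. -/

section

variable {K : Type w} [Field K]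

theorem mapDomain_baryFace_cycMonomialD (f : CyclicPartition q (k + 2) →₀ MvPolynomial V K) :
    Finsupp.mapDomain G.baryFace (G.cycMonomialD K q (k + 1) f) =
      (G.bary q).cellularD K k (Finsupp.mapDomain G.baryFace f) := by
  suffices h : Finsupp.lmapDomain _ (MvPolynomial V K) G.baryFace ∘ₗ G.cycMonomialD K q (k + 1) =
      (G.bary q).cellularD K k ∘ₗ Finsupp.lmapDomain _ (MvPolynomial V K) G.baryFace from
    LinearMap.congr_fun h f
  refine Finsupp.lhom_ext' fun p => LinearMap.ext_ring ?_
  simp only [LinearMap.comp_apply, Finsupp.lsingle_apply, Finsupp.lmapDomain_apply,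
    Finsupp.mapDomain_single, LabeledComplex.cellularD, cycMonomialD,
    Finsupp.linearCombination_single, one_smul]
  rw [Finsupp.mapDomain_finsetSum]
  refine Finset.sum_congr rfl fun s _ => ?_
  rw [Finsupp.mapDomain_single, ← baryFace_merge, monomial_eq_arrow G fun i => by
    rw [label_baryFace, label_baryFace, G.later_merge p s i, add_sub_cancel_left]]

theorem cycMonomialD_single_apply_whole (p : CyclicPartition q 1) :
    G.cycMonomialD K q 0 (Finsupp.single p 1) (CyclicPartition.whole q) =
      G.arrow K (p.block 0) (p.block 1) := by
  rw [cycMonomialD, Finsupp.linearCombination_single, one_smul]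
  simp [Subsingleton.elim (p.merge 0) (CyclicPartition.whole q)]

theorem cycD_single_apply_whole (p : CyclicPartition q 1) :
    G.cycD K q 0 (Finsupp.single p 1) (CyclicPartition.whole q) =
      G.arrow K (p.block 0) (p.block 1) - G.arrow K (p.block 1) (p.block 0) := by
  rw [cycD, Finsupp.linearCombination_single, one_smul]
  simp [Subsingleton.elim (p.merge 0) (CyclicPartition.whole q),
    Subsingleton.elim p.mergeEnds (CyclicPartition.whole q)]

theorem later_eq_arrowExp (p : CyclicPartition q 1) (i : V) :
    G.later p i = G.arrowExp (p.block 0) (p.block 1) i := by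
  have h : G.later (p.merge 0) i = 0 := by
    rw [later]
    refine Finset.sum_eq_zero fun j _ => ?_
    rw [Subsingleton.elim (α := Fin 1) ((p.merge 0).1 i) ((p.merge 0).1 j)]
    simp
  rw [G.later_merge p 0, h, zero_add]
  rfl

theorem algebraMap_cycMonomialD (f : CyclicPartition q 1 →₀ MvPolynomial V K) :
    algebraMap (MvPolynomial V K) (Laurent V K)
        (G.cycMonomialD K q 0 f (CyclicPartition.whole q)) =
      (G.bary q).cellularAug K (Finsupp.mapDomain G.baryFace f) := by
  suffices h : Algebra.linearMap (MvPolynomial V K) (Laurent V K) ∘ₗ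
      Finsupp.lapply (CyclicPartition.whole q) ∘ₗ G.cycMonomialD K q 0 =
      (G.bary q).cellularAug K ∘ₗ Finsupp.lmapDomain _ (MvPolynomial V K) G.baryFace from
    LinearMap.congr_fun h f
  refine Finsupp.lhom_ext' fun p => LinearMap.ext_ring ?_
  simp only [LinearMap.comp_apply, Finsupp.lsingle_apply, Finsupp.lmapDomain_apply,
    Finsupp.mapDomain_single, Finsupp.lapply_apply, cycMonomialD_single_apply_whole]
  rw [LabeledComplex.cellularAug, Finsupp.linearCombination_single, one_smul]
  refine (Laurent.algebraMap_monomial _).trans (congrArg _ (funext fun i => ?_))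
  rw [label_baryFace, later_eq_arrowExp]

theorem cycSupportedOnBary (K : Type w) [Field K] (q : V) : G.CycSupportedOnBary K q :=
  ⟨fun _ => Equiv.ofBijective _ G.baryFace_bijective, fun _ p t i => G.mem_baryFace p t i,
    fun _ f => G.mapDomain_baryFace_cycMonomialD f, fun f => G.algebraMap_cycMonomialD f⟩

end

end Multigraph

/-! ### The free resolutions of the two quotient rings. -/

namespace Laurent

theorem algebraMap_injective {V : Type u} [Fintype V] [DecidableEq V] {K : Type v} [Field K] :
    Function.Injective (algebraMap (MvPolynomial V K) (Laurent V K)) := by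
  rw [injective_iff_map_eq_zero]
  intro f hf
  ext u
  have h : (monoBasis V K).coord (fun i => (u i : ℤ)) ∘ₗ
      (Algebra.linearMap (MvPolynomial V K) (Laurent V K)).restrictScalars K =
      lcoeff K u := by
    classical
    refine (basisMonomials V K).ext fun a => ?_
    rw [coe_basisMonomials]
    simp only [LinearMap.comp_apply, LinearMap.restrictScalars_apply, Algebra.linearMap_apply,
      algebraMap_monomial, ← monoBasis_apply, Module.Basis.coord_apply, Module.Basis.repr_self,
      lcoeff_apply, coeff_monomial, Finsupp.single_apply]
    refine if_congr ⟨fun h => Finsupp.ext fun i => ?_, fun h => by rw [h]⟩ rfl rfl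
    exact_mod_cast congrFun h i
  have h1 := LinearMap.congr_fun h f
  simp only [LinearMap.comp_apply, LinearMap.restrictScalars_apply, Algebra.linearMap_apply, hf,
    map_zero, lcoeff_apply] at h1
  simp [← h1]

end Laurent

namespace Multigraph

variable {V : Type u} {q : V} {K : Type w} [Field K]

theorem cycAug_apply {I : Ideal (MvPolynomial V K)}
    (f : CyclicPartition q 0 →₀ MvPolynomial V K) :
    cycAug q I f = Ideal.Quotient.mk I (f (CyclicPartition.whole q)) := by
  have hf : f = Finsupp.single (CyclicPartition.whole q) (f (CyclicPartition.whole q)) :=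
    Finsupp.unique_ext (by
      rw [Subsingleton.elim default (CyclicPartition.whole q), Finsupp.single_eq_same])
  rw [hf, cycAug, Finsupp.linearCombination_single, Finsupp.single_eq_same]
  change Ideal.Quotient.mk I (f (CyclicPartition.whole q) * 1) = _
  rw [mul_one]

theorem cycAug_surjective (I : Ideal (MvPolynomial V K)) : Function.Surjective (cycAug q I) := by
  intro x
  obtain ⟨f, rfl⟩ := Ideal.Quotient.mk_surjective x
  exact ⟨Finsupp.single (CyclicPartition.whole q) f, by rw [cycAug_apply, Finsupp.single_eq_same]⟩

/-- The target has rank one, so the image of `d` is the ideal generated by the images of the basis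
vectors. -/
theorem exact_cycAug {B : Type*} {I : Ideal (MvPolynomial V K)}
    {d : (B →₀ MvPolynomial V K) →ₗ[MvPolynomial V K]
      (CyclicPartition q 0 →₀ MvPolynomial V K)}
    (hd : Ideal.span (Set.range fun b => d (Finsupp.single b 1) (CyclicPartition.whole q)) = I) :
    Function.Exact d (cycAug q I) := by
  have h : Finsupp.lapply (CyclicPartition.whole q) ∘ₗ d = Finsupp.linearCombination _
      fun b => d (Finsupp.single b 1) (CyclicPartition.whole q) := by
    refine Finsupp.lhom_ext' fun b => LinearMap.ext_ring ?_
    simp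
  intro f
  rw [cycAug_apply, Ideal.Quotient.eq_zero_iff_mem, ← hd, Ideal.span,
    ← Finsupp.range_linearCombination, ← h]
  constructor
  · rintro ⟨g, hg⟩
    refine ⟨g, Finsupp.unique_ext ?_⟩
    rw [Subsingleton.elim default (CyclicPartition.whole q)]
    exact hg
  · rintro ⟨g, rfl⟩
    exact ⟨g, rfl⟩

variable [Fintype V] [DecidableEq V] {G : Multigraph V}

theorem block_one (p : CyclicPartition q 1) : p.block 1 = (p.block 0)ᶜ := by
  ext i
  rw [Finset.mem_compl, p.mem_block, p.mem_block]
  rcases Fin.exists_fin_two.1 ⟨p.1 i, rfl⟩ with h | h <;> simp [h]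

theorem exists_block_eq {I : Finset V} (hI : I.Nonempty) (hq : q ∉ I) :
    ∃ p : CyclicPartition q 1, p.block 0 = I := by
  refine ⟨⟨fun i => if i ∈ I then 0 else 1, fun s => ?_, by simp [hq]⟩, ?_⟩
  · rcases Fin.exists_fin_two.1 ⟨s, rfl⟩ with h | h
    · obtain ⟨i, hi⟩ := hI
      exact ⟨i, by simp [hi, h]⟩
    · exact ⟨q, by simp [hq, h]⟩
  · ext i
    rw [CyclicPartition.mem_block]
    by_cases hi : i ∈ I <;> simp [hi]

theorem Connected.isFreeResolution_cycD (hG : G.Connected) (K : Type w) [Field K] (q : V) :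
    IsFreeResolution (G.cycD K q) (cycAug q (G.topplingIdeal K)) := by
  refine ⟨cycAug_surjective _, exact_cycAug (le_antisymm ?_ ?_), hG.exact_cycD K q⟩
  · refine Ideal.span_le.2 ?_
    rintro _ ⟨p, rfl⟩
    simp only [cycD_single_apply_whole, block_one]
    exact G.arrow_sub_arrow_mem_topplingIdeal _
  · refine G.topplingIdeal_le fun I hI hI' => ?_
    -- The two-block partitions list each split once, with `q` in the second block; the other
    -- orientation is the negative.
    have key : ∀ I : Finset V, I.Nonempty → q ∉ I → G.arrow K I Iᶜ - G.arrow K Iᶜ I ∈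
        Ideal.span (Set.range fun p : CyclicPartition q 1 =>
          G.cycD K q 0 (Finsupp.single p 1) (CyclicPartition.whole q)) := by
      intro I hI hq
      obtain ⟨p, rfl⟩ := exists_block_eq hI hq
      refine Ideal.subset_span ⟨p, ?_⟩
      simp only [cycD_single_apply_whole, block_one]
    by_cases hq : q ∈ I
    · have := key Iᶜ hI' (by simpa using hq)
      rw [compl_compl] at this
      simpa using neg_mem this
    · exact key I hI hq

theorem isFreeResolution_cycMonomialD (G : Multigraph V) (K : Type w) [Field K] (q : V) :
    IsFreeResolution (G.cycMonomialD K q) (cycAug q (G.parkingIdeal K q)) := by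
  obtain ⟨-, -, h0, hs⟩ := G.bary_isCellularResolution K q
  have hbij : ∀ n, Function.Bijective (Finsupp.mapDomain (M := MvPolynomial V K)
      (G.baryFace (q := q) (k := n))) := fun n =>
    ⟨Finsupp.mapDomain_injective G.baryFace_bijective.1,
      Finsupp.mapDomain_surjective G.baryFace_bijective.2⟩
  refine ⟨cycAug_surjective _, exact_cycAug (le_antisymm ?_ ?_), fun k f => ?_⟩
  · refine Ideal.span_le.2 ?_
    rintro _ ⟨p, rfl⟩
    simp only [cycMonomialD_single_apply_whole, block_one]
    refine Ideal.subset_span ⟨p.block 0, ?_, ?_, rfl⟩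
    · obtain ⟨i, hi⟩ := p.surjective 0
      exact ⟨i, (p.mem_block 0 i).2 hi⟩
    · rw [p.mem_block, p.map_base]
      exact Fin.last_pos.ne'
  · refine Ideal.span_mono ?_
    rintro _ ⟨I, hI, hq, rfl⟩
    obtain ⟨p, rfl⟩ := exists_block_eq hI hq
    refine ⟨p, ?_⟩
    simp only [cycMonomialD_single_apply_whole, block_one]
  · have hrange : f ∈ Set.range (G.cycMonomialD K q (k + 1)) ↔
        Finsupp.mapDomain G.baryFace f ∈ Set.range ((G.bary q).cellularD K k) := by
      constructor
      · rintro ⟨g, rfl⟩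
        exact ⟨_, (G.mapDomain_baryFace_cycMonomialD g).symm⟩
      · rintro ⟨g, hg⟩
        obtain ⟨g, rfl⟩ := (hbij _).2 g
        rw [← G.mapDomain_baryFace_cycMonomialD] at hg
        exact ⟨g, (hbij _).1 hg⟩
    rw [hrange]
    -- Homological degrees are shifted by one against `Bary(G)`: the lowest case is exactness at the
    -- augmentation, which is carried back from Laurent polynomials to `K[x]` by injectivity of the
    -- inclusion.
    cases k with
    | zero =>
      rw [← h0, Subtype.ext_iff, LinearMap.codRestrict_apply, ← G.algebraMap_cycMonomialD]
      refine Iff.trans ?_ (map_eq_zero_iff _ Laurent.algebraMap_injective).symm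
      refine ⟨fun h => by rw [h]; rfl, fun h => Finsupp.unique_ext ?_⟩
      rw [Subsingleton.elim default (CyclicPartition.whole q), h]
      rfl
    | succ k =>
      rw [← hs k, ← G.mapDomain_baryFace_cycMonomialD]
      exact (map_eq_zero_iff (Finsupp.mapDomain.addMonoidHom G.baryFace) (hbij k).1).symm

end Multigraph

/-- Generators, Gröbner bases and cellular free resolutions of the toppling ideal `I_G` and of the
monomial ideal `M_G` of an arbitrary connected multigraph. -/
theorem mainTheorem3 {K : Type v} [Field K] {V : Type u} [Fintype V] [DecidableEq V]
    (G : Multigraph V) (hG : G.Connected) :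
    -- the connected split binomials generate the toppling ideal
    G.topplingIdeal K = Ideal.span (G.connectedSplitBinomials K) ∧
    ∀ q : V,
      -- they form a Gröbner basis with initial ideal `M_G` for every spanning tree order
      (∀ m : MonomialOrder.{u, w} V, G.IsSpanningTreeOrder q m →
        IsGroebnerBasis m (G.connectedSplitBinomials K) (G.topplingIdeal K) ∧
        initialIdeal m (G.topplingIdeal K) = G.parkingIdeal K q) ∧
      -- `CYC_G` is a free resolution of `K[x]/I_G`; it is cellular: the quotient by the lattice
      -- of the cellular resolution of the lattice module supported on `Apt(G)`
      (IsFreeResolution (G.cycD K q) (Multigraph.cycAug q (G.topplingIdeal K)) ∧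
        (G.apt q).IsCellularResolution (G.latticeModule K) ∧
        G.CycSupportedOnApt K q) ∧
      -- dropping the last term gives a free resolution of `K[x]/M_G`; it is cellular:
      -- supported on `Bary(G)`
      (IsFreeResolution (G.cycMonomialD K q) (Multigraph.cycAug q (G.parkingIdeal K q)) ∧
        (G.bary q).IsCellularResolution
          (Submodule.map (Algebra.linearMap (MvPolynomial V K) (Laurent V K))
            (G.parkingIdeal K q)) ∧
        G.CycSupportedOnBary K q) := by
  exact ⟨hG.topplingIdeal_eq_span, fun q =>
    ⟨fun _ hm => hG.initialIdeal_topplingIdeal fun _ hI hq => hm.arrowExp_lt hI hq,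
      ⟨hG.isFreeResolution_cycD K q, hG.apt_isCellularResolution K q, G.cycSupportedOnApt K q⟩,
      G.isFreeResolution_cycMonomialD K q, G.bary_isCellularResolution K q,
      G.cycSupportedOnBary K q⟩⟩
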